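/- Let $m\ge 1$, $d_v\ge 2$, $d_c\ge 2$. For $0\le i,j,k\le m$ let $V_{i,j,k}$ (resp. $C_{i,j,k}$) be the probability that a uniformly random $j$-dimensional subspace of $\mathbb F_2^m$ has intersection (resp. sum) of dimension $k$ with a given $i$-dimensional subspace. For vectors $a,b\in\mathbb R^{m+1}$ (indices $0,\dots,m$) put $[a\boxdot b]_k=\sum_{i,j}V_{i,j,k}a_ib_j$ and $[a\boxtimes b]_k=\sum_{i,j}C_{i,j,k}a_ib_j$. For $x=(x_1,\dots,x_m)$ let $x_\circ=(x_i-x_{i+1})_{0\le i\le m}$ with $x_0=1$, $x_{m+1}=0$. Let $p_\circ(\varepsilon)_i=\binom mi\varepsilon^i(1-\varepsilon)^{m-i}$ and $p(\varepsilon)_i=\sum_{k\ge i}p_\circ(\varepsilon)_k$. The density-evolution (DE) updates of the $(d_v,d_c,m)$ LDPC ensemble over $\mathrm{GF}(2^m)$ on the binary erasure channel with erasure probability $\varepsilon\in[0,1]$ are $$f_i(y;\varepsilon)=\sum_{k=i}^m\big[p_\circ(\varepsilon)\boxdot(\boxdot^{d_v-1}y_\circ)\big]_k,\qquad g_i(x)=\sum_{k=i}^m\big[\boxtimes^{d_c-1}x_\circ\big]_k,\qquad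 1\le i\le m,$$ and $\mathcal X_\varepsilon=\{x:\ x_1\ge\dots\ge x_m,\ 0\le x_i\le p(\varepsilon)_i\}$ is the set of possible values of $x$. **(0)** There are a symmetric matrix $D\in\mathbb R^{m\times m}$ with positive entries and nonzero determinant and scalar functions $F(y;\varepsilon)$, $G(x)$ with $F(0;\varepsilon)=G(0)=0$ and gradients $F'(y;\varepsilon)=f(y;\varepsilon)D$, $G'(x)=g(x)D$ (row vectors), for all $\varepsilon\in[0,1]$. Fix any such $D,F,G$. Let $U(x;\varepsilon)=g(x)Dx^{T}-G(x)-F(g(x);\varepsilon)$. Let $\mathcal U_0(\varepsilon)$ be the set of $x\in\mathcal X_\varepsilon$ from which the iteration $x\mapsto f(g(x);\varepsilon)$ converges to $0$, and let $\Delta E(\varepsilon)=\inf_{x\in\mathcal X_\varepsilon\setminus\mathcal U_0(\varepsilon)}U(x;\varepsilon)\in[-\infty,+\infty]$ ($+\infty$ for the empty set). Let $\varepsilon^{BP}$ be the supremum of the $\varepsilon\in[0,1]$ such that all partial derivatives of $U(\cdot;\varepsilon)$ are positive at every $x\in\mathcal X_\varepsilon\setminus\{0\}$, and let $\varepsilon^*=\sup\{\varepsilon\in(\varepsilon^{BP},1]:\Delta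 E(\varepsilon)\ge0\}$ (read as $\varepsilon^{BP}$ if this set is empty). For $L,w\ge1$ let $A$ be the $L\times(L+w-1)$ matrix with $A_{t,i}=1/w$ if $t\le i\le t+w-1$ and $0$ otherwise. For a matrix $X$ with rows $x_1,\dots,x_{L+w-1}\in\mathbb R^m$ let $\mathbf G(X)$ have rows $g(x_i)$, and for an $L\times m$ matrix $Y$ let $\mathbf F(Y;\varepsilon)$ have rows $f(y_t;\varepsilon)$. DE of the spatially coupled $(d_v,d_c,m,L,w)$ ensemble is the iteration $X\mapsto A^{T}\mathbf F(A\mathbf G(X);\varepsilon)$ on matrices with rows in $\mathcal X_\varepsilon$. The coupled potential is $$U(X;\varepsilon)=\operatorname{Tr}(\mathbf G(X)DX^{T})-\sum_{i=1}^{L+w-1}G(x_i)-\sum_{t=1}^{L}F\big((A\mathbf G(X))_t;\varepsilon\big),$$ and $U''(X;\varepsilon)$ is its Hessian with respect to all entries of $X$; $\|\cdot\|_\infty$ is the maximal absolute row sum. **(1)** Let $\varepsilon\in[0,1]$ with $\varepsilon<\varepsilon^*$, and let $K$ satisfy $\|U''(X;\varepsilon)\|_\infty\le K$ for all $X$ with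 rows in $\mathcal X_\varepsilon$. If $w>\dfrac{mK}{2\,\Delta E(\varepsilon)}$, in the sense that $\dfrac{mK}{2w}<\Delta E(\varepsilon)$, then among the matrices $X$ with rows in $\mathcal X_\varepsilon$ the only fixed point of the coupled DE is $X=0$, and the coupled DE started at any such $X$ converges to $0$ (decoding succeeds). -/

import Mathlib

open Set Filter Topology

noncomputable section

namespace NBLDPC

/-- Linear subspaces of the binary vector space of dimension `m`. -/
abbrev Subsp (m : ℕ) : Type := Submodule (ZMod 2) (Fin m → ZMod 2)

/-- Number of subspaces of dimension `j`. -/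
def numSubsp (m j : ℕ) : ℕ :=
  Nat.card {W : Subsp m // Module.finrank (ZMod 2) W = j}

/-- Probability that the intersection of two independent uniformly random subspaces of dimensions
`i` and `j` has dimension `k`. Since the general linear group acts transitively on the subspaces of
dimension `i`, this is also the probability that a uniformly random subspace of dimension `j` meets
any given subspace of dimension `i` in dimension `k`. -/
def probInter (m i j k : ℕ) : ℝ :=
  (Nat.card {P : Subsp m × Subsp m // Module.finrank (ZMod 2) P.1 = i ∧
      Module.finrank (ZMod 2) P.2 = j ∧
      Module.finrank (ZMod 2) (P.1 ⊓ P.2 : Subsp m) = k} : ℝ) /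
    ((numSubsp m i : ℝ) * (numSubsp m j : ℝ))

/-- The same with the sum of the two subspaces in place of the intersection. -/
def probSum (m i j k : ℕ) : ℝ :=
  (Nat.card {P : Subsp m × Subsp m // Module.finrank (ZMod 2) P.1 = i ∧
      Module.finrank (ZMod 2) P.2 = j ∧
      Module.finrank (ZMod 2) (P.1 ⊔ P.2 : Subsp m) = k} : ℝ) /
    ((numSubsp m i : ℝ) * (numSubsp m j : ℝ))

/-- Variable-node combination of two vectors of dimension probabilities (entries `0, …, m`). -/
def boxdot {m : ℕ} (a b : Fin (m + 1) → ℝ) : Fin (m + 1) → ℝ :=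
  fun k => ∑ i : Fin (m + 1), ∑ j : Fin (m + 1), probInter m i j k * a i * b j

/-- Check-node combination of two vectors of dimension probabilities. -/
def boxtimes {m : ℕ} (a b : Fin (m + 1) → ℝ) : Fin (m + 1) → ℝ :=
  fun k => ∑ i : Fin (m + 1), ∑ j : Fin (m + 1), probSum m i j k * a i * b j

/-- `a ⊡ a ⊡ ⋯ ⊡ a` with `n` terms (`n ≥ 1`). -/
def boxdotPow {m : ℕ} (a : Fin (m + 1) → ℝ) (n : ℕ) : Fin (m + 1) → ℝ :=
  (boxdot a)^[n - 1] a

/-- `a ⊠ a ⊠ ⋯ ⊠ a` with `n` terms (`n ≥ 1`). -/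
def boxtimesPow {m : ℕ} (a : Fin (m + 1) → ℝ) (n : ℕ) : Fin (m + 1) → ℝ :=
  (boxtimes a)^[n - 1] a

/-- CCDF vector `x_i = ∑_{k=i}^m a_k`, `1 ≤ i ≤ m`; the entry `x_i` is stored at index `i - 1`. -/
def toCCDF {m : ℕ} (a : Fin (m + 1) → ℝ) : Fin m → ℝ :=
  fun i => ∑ k ∈ Finset.Ici i.succ, a k

/-- The vector `(x_i - x_{i+1})_{0 ≤ i ≤ m}`, with `x_0 = 1` and `x_{m+1} = 0`, of dimension
probabilities that has CCDF vector `x`. -/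
def ofCCDF {m : ℕ} (x : Fin m → ℝ) : Fin (m + 1) → ℝ :=
  fun i => (Fin.cons 1 x : Fin (m + 1) → ℝ) i - (Fin.snoc x 0 : Fin (m + 1) → ℝ) i

/-- Distribution of the dimension of the channel message on the erasure channel. -/
def channelProb (m : ℕ) (ε : ℝ) : Fin (m + 1) → ℝ :=
  fun i => (m.choose i : ℝ) * ε ^ (i : ℕ) * (1 - ε) ^ (m - (i : ℕ))

/-- CCDF vector of the channel message. -/
def channelCCDF (m : ℕ) (ε : ℝ) : Fin m → ℝ := toCCDF (channelProb m ε)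

/-- Variable-node update in CCDF form. -/
def f {m : ℕ} (dv : ℕ) (ε : ℝ) (y : Fin m → ℝ) : Fin m → ℝ :=
  toCCDF (boxdot (channelProb m ε) (boxdotPow (ofCCDF y) (dv - 1)))

/-- Check-node update in CCDF form. -/
def g {m : ℕ} (dc : ℕ) (x : Fin m → ℝ) : Fin m → ℝ :=
  toCCDF (boxtimesPow (ofCCDF x) (dc - 1))

/-- The set of possible values of `x`: CCDF vectors (hence nonincreasing in the index) with
`0 ≤ x_i ≤ p_i(ε)`. -/
def domX (m : ℕ) (ε : ℝ) : Set (Fin m → ℝ) :=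
  {x | Antitone x ∧ ∀ i, 0 ≤ x i ∧ x i ≤ channelCCDF m ε i}

/-- `(D, F, G)` is admissible for the definition of a potential function: `D` is symmetric with
positive entries and nonzero determinant, `F(0; ε) = 0`, `G(0) = 0`, and the gradients of
`F(·; ε)` and `G` are the row vectors `f(·; ε) D` and `g(·) D`. -/
structure IsPotentialData {m : ℕ} (dv dc : ℕ) (D : Matrix (Fin m) (Fin m) ℝ)
    (F : (Fin m → ℝ) → ℝ → ℝ) (G : (Fin m → ℝ) → ℝ) : Prop where
  symm : D.IsSymm
  pos : ∀ i j, 0 < D i j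
  det_ne_zero : D.det ≠ 0
  F_zero : ∀ ε ∈ Icc (0 : ℝ) 1, F 0 ε = 0
  G_zero : G 0 = 0
  F_grad : ∀ ε ∈ Icc (0 : ℝ) 1, ∀ y, HasFDerivAt (fun z => F z ε)
    (∑ i, (Matrix.vecMul (f dv ε y) D i) • ContinuousLinearMap.proj (R := ℝ) i) y
  G_grad : ∀ x, HasFDerivAt G
    (∑ i, (Matrix.vecMul (g dc x) D i) • ContinuousLinearMap.proj (R := ℝ) i) x

/-- Potential function `U(x; ε) = g(x) D xᵀ - G(x) - F(g(x); ε)` of the uncoupled system. -/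
def potential {m : ℕ} (dc : ℕ) (D : Matrix (Fin m) (Fin m) ℝ) (F : (Fin m → ℝ) → ℝ → ℝ)
    (G : (Fin m → ℝ) → ℝ) (x : Fin m → ℝ) (ε : ℝ) : ℝ :=
  g dc x ⬝ᵥ D.mulVec x - G x - F (g dc x) ε

/-- Initial values in `domX` from which uncoupled density evolution tends to `0`. -/
def basinZero (m dv dc : ℕ) (ε : ℝ) : Set (Fin m → ℝ) :=
  {x | x ∈ domX m ε ∧ Tendsto (fun ℓ : ℕ => (fun z => f dv ε (g dc z))^[ℓ] x) atTop (𝓝 0)}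

/-- Energy gap; the infimum over the empty set is `+∞`. -/
def energyGap {m : ℕ} (dv dc : ℕ) (D : Matrix (Fin m) (Fin m) ℝ) (F : (Fin m → ℝ) → ℝ → ℝ)
    (G : (Fin m → ℝ) → ℝ) (ε : ℝ) : EReal :=
  ⨅ x ∈ domX m ε \ basinZero m dv dc ε, (potential dc D F G x ε : EReal)

/-- BP threshold: supremum of the `ε` for which all partial derivatives of `U(·; ε)` are positive
at all nonzero `x` (at `x = 0` they vanish). -/
def thresholdBP {m : ℕ} (dc : ℕ) (D : Matrix (Fin m) (Fin m) ℝ) (F : (Fin m → ℝ) → ℝ → ℝ)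
    (G : (Fin m → ℝ) → ℝ) : ℝ :=
  sSup {ε | ε ∈ Icc (0 : ℝ) 1 ∧ ∀ x ∈ domX m ε, x ≠ 0 →
    ∀ i, 0 < fderiv ℝ (fun z => potential dc D F G z ε) x (Pi.single i 1)}

/-- Potential threshold: supremum of the `ε` above the BP threshold with nonnegative energy gap;
it is the BP threshold if there are none. -/
def thresholdPot {m : ℕ} (dv dc : ℕ) (D : Matrix (Fin m) (Fin m) ℝ) (F : (Fin m → ℝ) → ℝ → ℝ)
    (G : (Fin m → ℝ) → ℝ) : ℝ :=
  sSup (insert (thresholdBP dc D F G)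
    {ε | ε ∈ Ioc (thresholdBP dc D F G) 1 ∧ 0 ≤ energyGap dv dc D F G ε})

/-- The `L × (L + w - 1)` coupling matrix: row `t` is `1 / w` in the columns `t, …, t + w - 1`. -/
def coupling (L w : ℕ) : Matrix (Fin L) (Fin (L + w - 1)) ℝ :=
  Matrix.of fun t i => if (t : ℕ) ≤ i ∧ (i : ℕ) < t + w then 1 / (w : ℝ) else 0

/-- Apply a vector function to every row of a matrix. -/
def mapRows {n m : ℕ} (φ : (Fin m → ℝ) → Fin m → ℝ) (X : Matrix (Fin n) (Fin m) ℝ) :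
    Matrix (Fin n) (Fin m) ℝ :=
  Matrix.of fun i => φ (X i)

/-- One iteration of coupled density evolution, `X ↦ Aᵀ F(A G(X); ε)`. -/
def coupledDE {m : ℕ} (dv dc L w : ℕ) (ε : ℝ) (X : Matrix (Fin (L + w - 1)) (Fin m) ℝ) :
    Matrix (Fin (L + w - 1)) (Fin m) ℝ :=
  (coupling L w).transpose * mapRows (f dv ε) (coupling L w * mapRows (g dc) X)

/-- Matrices all of whose rows are possible values of `x`. -/
def coupledDom (m L w : ℕ) (ε : ℝ) : Set (Matrix (Fin (L + w - 1)) (Fin m) ℝ) :=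
  {X | ∀ i, X i ∈ domX m ε}

/-- Coupled potential `U(X; ε) = Tr(G(X) D Xᵀ) - G(X) - F(A G(X); ε)`, where the scalar functions
`G` and `F` of a matrix are the sums of their values at its rows. -/
def coupledPotential {m : ℕ} (dc L w : ℕ) (D : Matrix (Fin m) (Fin m) ℝ)
    (F : (Fin m → ℝ) → ℝ → ℝ) (G : (Fin m → ℝ) → ℝ) (ε : ℝ)
    (X : Matrix (Fin (L + w - 1)) (Fin m) ℝ) : ℝ :=
  (mapRows (g dc) X * D * X.transpose).trace - ∑ i, G (X i) -
    ∑ t, F ((coupling L w * mapRows (g dc) X) t) ε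

/-- Hessian matrix of the coupled potential with respect to all entries of `X`. -/
def coupledHessian {m : ℕ} (dc L w : ℕ) (D : Matrix (Fin m) (Fin m) ℝ)
    (F : (Fin m → ℝ) → ℝ → ℝ) (G : (Fin m → ℝ) → ℝ) (ε : ℝ)
    (X : Matrix (Fin (L + w - 1)) (Fin m) ℝ) :
    Matrix (Fin (L + w - 1) × Fin m) (Fin (L + w - 1) × Fin m) ℝ :=
  let U : (Fin (L + w - 1) → Fin m → ℝ) → ℝ :=
    fun Z => coupledPotential dc L w D F G ε (Matrix.of Z)
  Matrix.of fun a b => fderiv ℝ (fderiv ℝ U) (Matrix.of.symm X)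
    (Pi.single a.1 (Pi.single a.2 1)) (Pi.single b.1 (Pi.single b.2 1))

section
attribute [local instance] Matrix.linftyOpNormedAddCommGroup

/-- Operator norm of a matrix for the sup norm on vectors (maximal absolute row sum). -/
def normInf {ι : Type} [Fintype ι] (M : Matrix ι ι ℝ) : ℝ := ‖M‖

end

end NBLDPC

end

open NBLDPC

/-!
Combining independent messages at a variable node means intersecting independent random subspaces
of `𝔽₂ᵐ`, and combining at a check node means adding them.

*Existence of the potential.* Averaging over the general linear group (`sum_probInter_mul`) shows
that the expected number of linearly independent `s`-tuples in a random subspace is multiplicative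
under intersection (`sum_probInter_indepCount`); this diagonalizes `⊡`. Orthogonal complements
exchange intersections and sums, so that `⊠` is `⊡` conjugated by the involution `x ↦ 1 - x ∘ rev`
of CCDF vectors (`g_eq`). The matrix `D` is the bilinear form `E dim (A ∩ B)` in CCDF coordinates
(`dimForm`). Since the dimension of a space is a combination, with nonzero coefficients, of its
numbers of independent tuples (`sum_dimCoeff_mul`), `D = Mᵀ Δ M` with `M` the triangular matrix that
diagonalizes `⊡` and `Δ` an invertible diagonal matrix, so that `f D` and `g D` are gradients of
sums of functions of one variable. For `g` one also needs that `D` is invariant under reversing both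
indices, which is the formula `dim (A + B) + dim (A ∩ B) = dim A + dim B` (`meanInter_rev`). The
entries of `D` are second differences of `E dim (A ∩ B)` along random flags, and supermodularity of
the dimension makes them positive (`meanInter_diff_pos`).

*Threshold saturation.* Monotonicity of `f` and `g` in the stochastic order lets coupled density
evolution be dominated by a one-sided system, in which the positions beyond the middle of the chain
copy the middle one (`iterate_coupledDE_le`). Started from the channel it decreases to a fixed point
`x` that increases along the chain. If `x ≠ 0`, its last value `z` satisfies `z ≤ f (g z)`, so the
uncoupled iteration does not take `z` to `0` and `U(z) ≥ ΔE`. Shifting `x` by one position lowers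
the coupled potential by at least `U(z)`, because everything else telescopes (`chainPot_shift_le`).
The derivative of the coupled potential at `x` in the direction of the shift is zero, because each
row either is stationary for density evolution or does not move (`hasDerivAt_chainPot`). A shift
moves every entry by at most `1 / w` and all entries together by at most `m`, so the second-order
term is at most `m K / (2 w)`. Hence `ΔE ≤ m K / (2 w)` (`energyGap_le_of_fixedPoint`), which is
excluded; so `x = 0` and coupled density evolution tends to `0`.
-/

namespace NBLDPC
noncomputable section
open scoped Pointwise

/-! ### Averaging over the general linear group -/

/-- For a finite group acting transitively on a finite set `X`, averaging a function over an orbit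
map `g ↦ g • x₀` is the same as averaging it over `X`. -/
theorem card_mul_sum_smul {Γ α : Type*} [Group Γ] [Fintype Γ] [MulAction Γ α] (X : Finset α)
    (hX : ∀ g : Γ, ∀ x ∈ X, g • x ∈ X) (htr : ∀ x ∈ X, ∀ y ∈ X, ∃ g : Γ, g • x = y)
    {x₀ : α} (hx₀ : x₀ ∈ X) (Ψ : α → ℝ) :
    (X.card : ℝ) * ∑ g : Γ, Ψ (g • x₀) = (Fintype.card Γ : ℝ) * ∑ x ∈ X, Ψ x := by
  have h1 : ∀ x ∈ X, ∑ g : Γ, Ψ (g • x) = ∑ g : Γ, Ψ (g • x₀) := by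
    intro x hx
    obtain ⟨u, rfl⟩ := htr x₀ hx₀ x hx
    simp_rw [smul_smul]
    exact Fintype.sum_equiv (Equiv.mulRight u) _ _ fun g => rfl
  have h2 : ∀ g : Γ, ∑ x ∈ X, Ψ (g • x) = ∑ x ∈ X, Ψ x := by
    intro g
    refine Finset.sum_bij' (fun x _ => g • x) (fun x _ => g⁻¹ • x) (fun x hx => hX g x hx)
      (fun x hx => hX g⁻¹ x hx) ?_ ?_ ?_ <;> simp
  calc (X.card : ℝ) * ∑ g : Γ, Ψ (g • x₀) = ∑ x ∈ X, ∑ g : Γ, Ψ (g • x) := by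
        rw [Finset.sum_congr rfl h1, Finset.sum_const, nsmul_eq_mul]
    _ = (Fintype.card Γ : ℝ) * ∑ x ∈ X, Ψ x := by
        rw [Finset.sum_comm, Finset.sum_congr rfl fun g _ => h2 g, Finset.sum_const, nsmul_eq_mul,
          Finset.card_univ]

/-- The general linear group of `𝔽₂ᵐ`. -/
abbrev GLin (m : ℕ) : Type := (Fin m → ZMod 2) ≃ₗ[ZMod 2] (Fin m → ZMod 2)

instance (m : ℕ) : Fintype (GLin m) :=
  haveI : Finite (GLin m) :=
    Finite.of_injective (fun e : GLin m => (e : (Fin m → ZMod 2) → Fin m → ZMod 2))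
      DFunLike.coe_injective
  Fintype.ofFinite _

instance (m : ℕ) : Fintype (Subsp m) := Fintype.ofFinite _

theorem card_GLin_pos (m : ℕ) : 0 < (Fintype.card (GLin m) : ℝ) :=
  Nat.cast_pos.2 Fintype.card_pos

/-- The standard complete flag of `𝔽₂ᵐ`. -/
def stdFlag (m : ℕ) (k : Fin (m + 1)) : Subsp m := (Pi.basisFun (ZMod 2) (Fin m)).flag k

theorem finrank_stdFlag (m : ℕ) (k : Fin (m + 1)) :
    Module.finrank (ZMod 2) (stdFlag m k) = k := by
  classical
  set b := Pi.basisFun (ZMod 2) (Fin m)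
  have h := (b.linearIndependent.comp (Fin.castLE (Nat.lt_succ_iff.1 k.2))
    (Fin.castLE_injective _))
  have h2 := finrank_span_eq_card h
  have h3 : Set.range (b ∘ Fin.castLE (Nat.lt_succ_iff.1 k.2)) = b '' {i | i.castSucc < k} := by
    rw [Set.range_comp]
    congr 1
    ext i
    simp only [Set.mem_range, Set.mem_ofPred_eq, Fin.lt_def, Fin.val_castSucc]
    exact ⟨by rintro ⟨l, rfl⟩; exact l.2, fun hi => ⟨⟨i, hi⟩, rfl⟩⟩
  rw [h3, Fintype.card_fin] at h2
  exact h2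

/-- The subspaces of dimension `i`. -/
def subspOfDim (m i : ℕ) : Finset (Subsp m) :=
  open Classical in Finset.univ.filter fun W : Subsp m => Module.finrank (ZMod 2) W = i

theorem mem_subspOfDim {m i : ℕ} {W : Subsp m} :
    W ∈ subspOfDim m i ↔ Module.finrank (ZMod 2) W = i := by
  simp [subspOfDim]

theorem card_subspOfDim (m i : ℕ) : (subspOfDim m i).card = numSubsp m i := by
  classical
  rw [numSubsp, Nat.card_eq_fintype_card, Fintype.card_subtype, subspOfDim]

theorem finrank_smul (m : ℕ) (g : GLin m) (W : Subsp m) :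
    Module.finrank (ZMod 2) (g • W : Subsp m) = Module.finrank (ZMod 2) W :=
  LinearEquiv.finrank_map_eq g W

theorem finrank_subsp_le (m : ℕ) (W : Subsp m) : Module.finrank (ZMod 2) W ≤ m := by
  simpa using Submodule.finrank_le W

theorem exists_smul_eq_of_finrank_eq {m : ℕ} {W W' : Subsp m}
    (h : Module.finrank (ZMod 2) W = Module.finrank (ZMod 2) W') : ∃ g : GLin m, g • W = W' := by
  obtain ⟨g, hg⟩ := Submodule.exists_linearEquiv_restrict_eq (LinearEquiv.ofFinrankEq W W' h)
  refine ⟨g, Submodule.eq_of_le_of_finrank_eq ?_ ((finrank_smul m g W).trans h)⟩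
  rintro _ ⟨x, hx, rfl⟩
  have := hg ⟨x, hx⟩
  simp only at this
  change g x ∈ W'
  rw [← this]
  exact Subtype.coe_prop _

/-- Averaging over the subspaces of dimension `i` is averaging over the translates of the standard
one. -/
theorem numSubsp_mul_sum_smul {m : ℕ} (i : Fin (m + 1)) (Ψ : Subsp m → ℝ) :
    (numSubsp m i : ℝ) * ∑ g : GLin m, Ψ (g • stdFlag m i) =
      (Fintype.card (GLin m) : ℝ) *
        ∑ W ∈ subspOfDim m i, Ψ W := by
  classical
  rw [← card_mul_sum_smul (Γ := GLin m) _ _ _ _ Ψ, card_subspOfDim]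
  · intro g W hW
    rw [mem_subspOfDim] at hW ⊢
    rw [finrank_smul, hW]
  · intro W hW W' hW'
    rw [mem_subspOfDim] at hW hW'
    exact exists_smul_eq_of_finrank_eq (hW.trans hW'.symm)
  · rw [mem_subspOfDim, finrank_stdFlag]

theorem numSubsp_pos {m : ℕ} (i : Fin (m + 1)) : 0 < (numSubsp m i : ℝ) := by
  classical
  rw [← card_subspOfDim, Nat.cast_pos, Finset.card_pos]
  exact ⟨stdFlag m i, mem_subspOfDim.2 (finrank_stdFlag m i)⟩

/-- Expectation of a function of the intersection dimension of two random subspaces. -/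
theorem sum_probInter_mul_eq_pairs {m : ℕ} (i j : ℕ) (Φ : ℕ → ℝ) :
    ∑ k : Fin (m + 1), probInter m i j k * Φ k =
      (∑ W ∈ subspOfDim m i, ∑ W' ∈ subspOfDim m j,
        Φ (Module.finrank (ZMod 2) (W ⊓ W' : Subsp m))) / (numSubsp m i * numSubsp m j) := by
  classical
  have hcard : ∀ k : Fin (m + 1), (Nat.card {P : Subsp m × Subsp m //
      Module.finrank (ZMod 2) P.1 = i ∧ Module.finrank (ZMod 2) P.2 = j ∧
      Module.finrank (ZMod 2) (P.1 ⊓ P.2 : Subsp m) = k} : ℝ) =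
      ∑ W ∈ subspOfDim m i, ∑ W' ∈ subspOfDim m j,
          if Module.finrank (ZMod 2) (W ⊓ W' : Subsp m) = k then (1 : ℝ) else 0 := by
    intro k
    rw [Nat.card_eq_fintype_card, Fintype.card_subtype, ← Finset.sum_product',
      ← Finset.sum_filter, Finset.sum_const, nsmul_eq_mul, mul_one]
    congr 1
    refine congrArg Finset.card ?_
    ext P
    simp [mem_subspOfDim, and_assoc]
  have hsum : ∀ W W' : Subsp m, ∑ k : Fin (m + 1),
      (if Module.finrank (ZMod 2) (W ⊓ W' : Subsp m) = k then (1 : ℝ) else 0) * Φ k =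
      Φ (Module.finrank (ZMod 2) (W ⊓ W' : Subsp m)) := by
    intro W W'
    have hlt : Module.finrank (ZMod 2) (W ⊓ W' : Subsp m) < m + 1 :=
      Nat.lt_succ_of_le (finrank_subsp_le m _)
    rw [Finset.sum_eq_single (⟨_, hlt⟩ : Fin (m + 1))]
    · simp
    · intro b _ hb
      rw [if_neg, zero_mul]
      intro h
      exact hb (Fin.ext h.symm)
    · simp
  simp_rw [probInter, div_mul_eq_mul_div, hcard]
  rw [← Finset.sum_div]
  congr 1
  simp_rw [Finset.sum_mul]
  rw [Finset.sum_comm]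
  refine Finset.sum_congr rfl fun W _ => ?_
  rw [Finset.sum_comm]
  exact Finset.sum_congr rfl fun W' _ => hsum W W'

/-- Expectation of a function of the intersection dimension of two random subspaces, as an average
over translates of the standard flag. -/
theorem sum_probInter_mul {m : ℕ} (i j : Fin (m + 1)) (Φ : ℕ → ℝ) :
    ∑ k : Fin (m + 1), probInter m i j k * Φ k =
      (∑ g : GLin m, ∑ h : GLin m,
        Φ (Module.finrank (ZMod 2) (g • stdFlag m i ⊓ h • stdFlag m j : Subsp m))) /
        (Fintype.card (GLin m) : ℝ) ^ 2 := by
  have hN := card_GLin_pos m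
  have hi := numSubsp_pos i
  have hj := numSubsp_pos j
  rw [sum_probInter_mul_eq_pairs, div_eq_div_iff (by positivity) (by positivity)]
  have e1 := numSubsp_mul_sum_smul i fun W => ∑ W' ∈ subspOfDim m j,
      Φ (Module.finrank (ZMod 2) (W ⊓ W' : Subsp m))
  have e2 : ∀ W : Subsp m, _ := fun W => numSubsp_mul_sum_smul j fun W' =>
      Φ (Module.finrank (ZMod 2) (W ⊓ W' : Subsp m))
  have e3 : (numSubsp m j : ℝ) * ∑ g : GLin m, ∑ h : GLin m,
        Φ (Module.finrank (ZMod 2) (g • stdFlag m i ⊓ h • stdFlag m j : Subsp m)) =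
      (Fintype.card (GLin m) : ℝ) * ∑ g : GLin m, ∑ W' ∈ subspOfDim m j,
          Φ (Module.finrank (ZMod 2) (g • stdFlag m i ⊓ W' : Subsp m)) := by
    rw [Finset.mul_sum, Finset.mul_sum]
    exact Finset.sum_congr rfl fun g _ => e2 _
  linear_combination (-(Fintype.card (GLin m) : ℝ)) * e1 - (numSubsp m i : ℝ) * e3

theorem probInter_nonneg (m i j k : ℕ) : 0 ≤ probInter m i j k := by
  unfold probInter; positivity

/-- The probability that two random subspaces of dimensions `i` and `j` have an intersection of
dimension at least `k`. -/
def interTail (m : ℕ) (i j : Fin (m + 1)) (k : ℕ) : ℝ :=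
  ∑ l : Fin (m + 1), probInter m i j l * if k ≤ l then 1 else 0

theorem interTail_eq {m : ℕ} (i j : Fin (m + 1)) (k : ℕ) : interTail m i j k =
    (∑ g : GLin m, ∑ h : GLin m,
      if k ≤ Module.finrank (ZMod 2) (g • stdFlag m i ⊓ h • stdFlag m j : Subsp m)
        then (1 : ℝ) else 0) / (Fintype.card (GLin m) : ℝ) ^ 2 :=
  sum_probInter_mul i j fun l => if k ≤ l then 1 else 0

theorem stdFlag_mono (m : ℕ) : Monotone (stdFlag m) := Module.Basis.flag_mono _

theorem interTail_mono {m : ℕ} {i i' j j' : Fin (m + 1)} (hi : i ≤ i') (hj : j ≤ j') (k : ℕ) :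
    interTail m i j k ≤ interTail m i' j' k := by
  rw [interTail_eq, interTail_eq]
  refine div_le_div_of_nonneg_right (Finset.sum_le_sum fun g _ => Finset.sum_le_sum fun h _ => ?_)
    (by positivity)
  have hle : (g • stdFlag m i ⊓ h • stdFlag m j : Subsp m) ≤ g • stdFlag m i' ⊓ h • stdFlag m j' :=
    inf_le_inf (Submodule.map_mono (stdFlag_mono m hi)) (Submodule.map_mono (stdFlag_mono m hj))
  have := Submodule.finrank_mono hle
  split_ifs <;> first | omega | norm_num

/-- An average over pairs of elements of the general linear group is bounded by a pointwise
bound. -/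
theorem avg_le {m : ℕ} {Ψ : GLin m → GLin m → ℝ} {c : ℝ} (h : ∀ u v, Ψ u v ≤ c) :
    (∑ u, ∑ v, Ψ u v) / (Fintype.card (GLin m) : ℝ) ^ 2 ≤ c := by
  have hN := card_GLin_pos m
  rw [div_le_iff₀ (by positivity)]
  refine (Finset.sum_le_sum fun u _ => Finset.sum_le_sum fun v _ => h u v).trans ?_
  simp only [Finset.sum_const, Finset.card_univ, nsmul_eq_mul]
  nlinarith

theorem interTail_le_left {m : ℕ} (i j : Fin (m + 1)) (k : ℕ) :
    interTail m i j k ≤ if k ≤ i then 1 else 0 := by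
  rw [interTail_eq]
  refine avg_le fun g h => ?_
  have := Submodule.finrank_mono (inf_le_left : (g • stdFlag m i ⊓ h • stdFlag m j : Subsp m) ≤ _)
  rw [finrank_smul, finrank_stdFlag] at this
  split_ifs <;> first | omega | norm_num

theorem interTail_le_right {m : ℕ} (i j : Fin (m + 1)) (k : ℕ) :
    interTail m i j k ≤ if k ≤ j then 1 else 0 := by
  rw [interTail_eq]
  refine avg_le fun g h => ?_
  have := Submodule.finrank_mono (inf_le_right : (g • stdFlag m i ⊓ h • stdFlag m j : Subsp m) ≤ _)
  rw [finrank_smul, finrank_stdFlag] at this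
  split_ifs <;> first | omega | norm_num

theorem interTail_zero {m : ℕ} (i j : Fin (m + 1)) : interTail m i j 0 = 1 := by
  have hN := card_GLin_pos m
  rw [interTail_eq]
  simp only [Nat.zero_le, if_true, Finset.sum_const, Finset.card_univ, nsmul_eq_mul]
  field_simp

theorem stdFlag_last (m : ℕ) : stdFlag m (Fin.last m) = ⊤ := Module.Basis.flag_last _

theorem smul_top_subsp {m : ℕ} (g : GLin m) : (g • (⊤ : Subsp m)) = ⊤ :=
  Submodule.eq_top_of_finrank_eq (by rw [finrank_smul]; simp)

theorem interTail_last {m : ℕ} (j : Fin (m + 1)) (k : ℕ) :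
    interTail m (Fin.last m) j k = if k ≤ j then 1 else 0 := by
  have hN := card_GLin_pos m
  rw [interTail_eq]
  have h : ∀ u v : GLin m, Module.finrank (ZMod 2)
      (u • stdFlag m (Fin.last m) ⊓ v • stdFlag m j : Subsp m) = j := fun u v => by
    rw [stdFlag_last, smul_top_subsp, top_inf_eq, finrank_smul, finrank_stdFlag]
  simp only [h, Finset.sum_const, Finset.card_univ, nsmul_eq_mul]
  field_simp

/-! ### Duality between intersections and sums -/

/-- The standard bilinear form on `𝔽₂ᵐ`. -/
def stdForm (m : ℕ) : LinearMap.BilinForm (ZMod 2) (Fin m → ZMod 2) :=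
  Matrix.toBilin' (1 : Matrix (Fin m) (Fin m) (ZMod 2))

theorem stdForm_nondegenerate (m : ℕ) : (stdForm m).Nondegenerate :=
  LinearMap.BilinForm.nondegenerate_toBilin'_iff_det_ne_zero.2 (by simp)

theorem stdForm_isRefl (m : ℕ) : (stdForm m).IsRefl := by
  intro x y h
  simp only [stdForm, Matrix.toBilin'_apply', Matrix.one_mulVec] at h ⊢
  rw [dotProduct_comm, h]

/-- Passing to the orthogonal complement, as a permutation of the subspaces of `𝔽₂ᵐ`. -/
def orthEquiv (m : ℕ) : Subsp m ≃ Subsp m :=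
  Function.Involutive.toPerm (stdForm m).orthogonal fun W =>
    LinearMap.BilinForm.orthogonal_orthogonal (stdForm_nondegenerate m) (stdForm_isRefl m) W

theorem finrank_orthEquiv {m : ℕ} (W : Subsp m) :
    Module.finrank (ZMod 2) (orthEquiv m W) = m - Module.finrank (ZMod 2) W := by
  have := LinearMap.BilinForm.finrank_orthogonal (stdForm_nondegenerate m) W
  rwa [Module.finrank_fin_fun] at this

theorem orthEquiv_sup {m : ℕ} (W W' : Subsp m) :
    orthEquiv m (W ⊔ W') = orthEquiv m W ⊓ orthEquiv m W' := by
  refine le_antisymm (le_inf (LinearMap.BilinForm.orthogonal_le le_sup_left)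
    (LinearMap.BilinForm.orthogonal_le le_sup_right)) ?_
  rintro x ⟨h1, h2⟩ y hy
  obtain ⟨u, hu, v, hv, rfl⟩ := Submodule.mem_sup.1 hy
  have e1 : stdForm m u x = 0 := h1 u hu
  have e2 : stdForm m v x = 0 := h2 v hv
  change stdForm m (u + v) x = 0
  rw [map_add, LinearMap.add_apply, e1, e2, add_zero]

theorem finrank_orthEquiv_eq_iff {m i : ℕ} (hi : i ≤ m) (W : Subsp m) :
    Module.finrank (ZMod 2) W = i ↔ Module.finrank (ZMod 2) (orthEquiv m W) = m - i := by
  rw [finrank_orthEquiv]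
  have := finrank_subsp_le m W
  omega

theorem numSubsp_sub {m i : ℕ} (hi : i ≤ m) : numSubsp m (m - i) = numSubsp m i :=
  (Nat.card_congr ((orthEquiv m).subtypeEquiv fun W => finrank_orthEquiv_eq_iff hi W)).symm

theorem probSum_eq {m i j k : ℕ} (hi : i ≤ m) (hj : j ≤ m) (hk : k ≤ m) :
    probSum m i j k = probInter m (m - i) (m - j) (m - k) := by
  unfold probSum probInter
  rw [numSubsp_sub hi, numSubsp_sub hj]
  congr 2
  refine Nat.card_congr (((orthEquiv m).prodCongr (orthEquiv m)).subtypeEquiv fun P => ?_)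
  rw [finrank_orthEquiv_eq_iff hi, finrank_orthEquiv_eq_iff hj, finrank_orthEquiv_eq_iff hk,
    orthEquiv_sup]
  rfl

theorem boxtimes_eq {m : ℕ} (a b : Fin (m + 1) → ℝ) :
    boxtimes a b = boxdot (a ∘ Fin.rev) (b ∘ Fin.rev) ∘ Fin.rev := by
  funext k
  simp only [boxtimes, boxdot, Function.comp]
  refine Fintype.sum_equiv Fin.revPerm _ _ fun i => Fintype.sum_equiv Fin.revPerm _ _ fun j => ?_
  simp only [Fin.revPerm_apply, Fin.rev_rev]
  rw [probSum_eq (Nat.lt_succ_iff.1 i.2) (Nat.lt_succ_iff.1 j.2) (Nat.lt_succ_iff.1 k.2)]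
  simp [Fin.val_rev]

theorem boxtimesPow_eq {m : ℕ} (a : Fin (m + 1) → ℝ) (n : ℕ) :
    boxtimesPow a n = boxdotPow (a ∘ Fin.rev) n ∘ Fin.rev := by
  unfold boxtimesPow boxdotPow
  induction n - 1 with
  | zero => funext k; simp
  | succ n ih =>
    rw [Function.iterate_succ_apply', Function.iterate_succ_apply', ih, boxtimes_eq]
    congr 2
    funext k
    simp

/-! ### Tail sums and stochastic order -/

/-- The CCDF vectors of probability vectors. -/
def ccdfSet (m : ℕ) : Set (Fin m → ℝ) := {x | Antitone x ∧ ∀ i, 0 ≤ x i ∧ x i ≤ 1}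

theorem toCCDF_eq_sum {m : ℕ} (a : Fin (m + 1) → ℝ) (i : Fin m) :
    toCCDF a i = ∑ k : Fin (m + 1), a k * if (i : ℕ) + 1 ≤ k then 1 else 0 := by
  unfold toCCDF
  simp only [mul_ite, mul_one, mul_zero]
  rw [← Finset.sum_filter]
  refine Finset.sum_congr ?_ fun _ _ => rfl
  ext k
  simp [Fin.le_def]

theorem sum_ite_succ_le {m : ℕ} (H : Fin (m + 1) → ℝ) (k : Fin (m + 1)) :
    ∑ i : Fin m, (if (i : ℕ) + 1 ≤ k then 1 else 0) * (H i.succ - H i.castSucc) = H k - H 0 := by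
  induction k using Fin.induction with
  | zero => simp
  | succ j ih =>
    have : ∀ i : Fin m, (if (i : ℕ) + 1 ≤ j.succ then (1 : ℝ) else 0) =
        (if (i : ℕ) + 1 ≤ j.castSucc then 1 else 0) + if i = j then 1 else 0 := by
      intro i
      simp only [Fin.val_succ, Fin.val_castSucc, Fin.ext_iff]
      split_ifs <;> first | omega | norm_num
    simp_rw [this, add_mul, Finset.sum_add_distrib, ih]
    simp

/-- Summation by parts. -/
theorem sum_mul_eq_toCCDF {m : ℕ} (a H : Fin (m + 1) → ℝ) :
    ∑ k, a k * H k =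
      (∑ k, a k) * H 0 + ∑ i : Fin m, toCCDF a i * (H i.succ - H i.castSucc) := by
  simp_rw [toCCDF_eq_sum, Finset.sum_mul]
  rw [Finset.sum_comm, ← Finset.sum_add_distrib]
  refine Finset.sum_congr rfl fun k _ => ?_
  simp_rw [mul_assoc]
  rw [← Finset.mul_sum, sum_ite_succ_le]
  ring

theorem sum_ofCCDF_mul {m : ℕ} (x : Fin m → ℝ) (H : Fin (m + 1) → ℝ) :
    ∑ k, ofCCDF x k * H k = H 0 + ∑ i : Fin m, x i * (H i.succ - H i.castSucc) := by
  simp only [ofCCDF, sub_mul, Finset.sum_sub_distrib]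
  rw [Fin.sum_univ_succ,
    Fin.sum_univ_castSucc (f := fun k => Fin.snoc (α := fun _ => ℝ) x 0 k * H k)]
  simp only [Fin.cons_zero, Fin.cons_succ, Fin.snoc_castSucc, Fin.snoc_last, mul_sub,
    Finset.sum_sub_distrib]
  ring

theorem sum_ofCCDF {m : ℕ} (x : Fin m → ℝ) : ∑ k, ofCCDF x k = 1 := by
  simpa using sum_ofCCDF_mul x 1

theorem toCCDF_ofCCDF {m : ℕ} (x : Fin m → ℝ) : toCCDF (ofCCDF x) = x := by
  funext r
  rw [toCCDF_eq_sum, sum_ofCCDF_mul x fun k => if (r : ℕ) + 1 ≤ k then 1 else 0]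
  have : ∀ i : Fin m, ((if (r : ℕ) + 1 ≤ i.succ then (1 : ℝ) else 0) -
      if (r : ℕ) + 1 ≤ i.castSucc then 1 else 0) = if i = r then 1 else 0 := by
    intro i
    simp only [Fin.val_succ, Fin.val_castSucc, Fin.ext_iff]
    split_ifs <;> first | omega | norm_num
  simp_rw [this]
  simp

theorem ofCCDF_toCCDF {m : ℕ} {a : Fin (m + 1) → ℝ} (ha : ∑ k, a k = 1) :
    ofCCDF (toCCDF a) = a := by
  funext k
  have h1 := sum_mul_eq_toCCDF a (Pi.single k 1)
  have h2 := sum_ofCCDF_mul (toCCDF a) (Pi.single k 1)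
  rw [ha, one_mul, ← h2] at h1
  simpa [Pi.single_apply] using h1.symm

theorem toCCDF_mem_ccdfSet {m : ℕ} {a : Fin (m + 1) → ℝ} (ha : a ∈ stdSimplex ℝ (Fin (m + 1))) :
    toCCDF a ∈ ccdfSet m := by
  refine ⟨fun i j hij => ?_, fun i => ⟨Finset.sum_nonneg fun k _ => ha.1 k, ?_⟩⟩
  · exact Finset.sum_le_sum_of_subset_of_nonneg
      (Finset.Ici_subset_Ici.2 (Fin.succ_le_succ_iff.2 hij)) fun k _ _ => ha.1 k
  · rw [← ha.2]
    exact Finset.sum_le_sum_of_subset_of_nonneg (Finset.subset_univ _) fun k _ _ => ha.1 k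

theorem ofCCDF_mem_stdSimplex {m : ℕ} {x : Fin m → ℝ} (hx : x ∈ ccdfSet m) :
    ofCCDF x ∈ stdSimplex ℝ (Fin (m + 1)) := by
  refine ⟨fun k => sub_nonneg.2 ?_, sum_ofCCDF x⟩
  cases k using Fin.lastCases with
  | last =>
    rw [Fin.snoc_last]
    generalize Fin.last m = k
    cases k using Fin.cases with
    | zero => simp
    | succ k => simpa using (hx.2 k).1
  | cast k =>
    rw [Fin.snoc_castSucc]
    obtain ⟨l, hl⟩ : ∃ l, l = k.castSucc := ⟨_, rfl⟩
    rw [← hl]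
    cases l using Fin.cases with
    | zero => simpa using (hx.2 k).2
    | succ l =>
      rw [Fin.cons_succ]
      refine hx.1 ?_
      simp only [Fin.ext_iff, Fin.val_succ, Fin.val_castSucc] at hl
      rw [Fin.le_def]
      omega

theorem sum_mul_le_of_toCCDF_le {m : ℕ} {a a' H : Fin (m + 1) → ℝ} (hs : ∑ k, a k = ∑ k, a' k)
    (hle : toCCDF a ≤ toCCDF a') (hH : Monotone H) : ∑ k, a k * H k ≤ ∑ k, a' k * H k := by
  rw [sum_mul_eq_toCCDF, sum_mul_eq_toCCDF, hs]
  refine add_le_add le_rfl (Finset.sum_le_sum fun i _ => mul_le_mul_of_nonneg_right (hle i) ?_)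
  exact sub_nonneg.2 (hH i.castSucc_le_succ)

theorem sum_boxdot_mul {m : ℕ} (a b Φ : Fin (m + 1) → ℝ) :
    ∑ k, boxdot a b k * Φ k =
      ∑ i, a i * ∑ j, b j * ∑ k : Fin (m + 1), probInter m i j k * Φ k := by
  simp only [boxdot, Finset.sum_mul, Finset.mul_sum]
  rw [Finset.sum_comm]
  refine Finset.sum_congr rfl fun i _ => ?_
  rw [Finset.sum_comm]
  refine Finset.sum_congr rfl fun j _ => Finset.sum_congr rfl fun k _ => ?_
  ring

theorem toCCDF_boxdot {m : ℕ} (a b : Fin (m + 1) → ℝ) (r : Fin m) :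
    toCCDF (boxdot a b) r = ∑ i, a i * ∑ j, b j * interTail m i j (r + 1) := by
  rw [toCCDF_eq_sum, sum_boxdot_mul a b fun k => if (r : ℕ) + 1 ≤ k then 1 else 0]
  rfl

theorem sum_boxdot {m : ℕ} (a b : Fin (m + 1) → ℝ) :
    ∑ k, boxdot a b k = (∑ k, a k) * ∑ k, b k := by
  have h := sum_boxdot_mul a b 1
  have h0 : ∀ i j : Fin (m + 1), ∑ k : Fin (m + 1), probInter m i j k = 1 := fun i j => by
    have := interTail_zero i j
    simpa [interTail] using this
  simp only [Pi.one_apply, mul_one, h0] at h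
  rw [h, Finset.sum_mul]

theorem boxdot_mem_stdSimplex {m : ℕ} {a b : Fin (m + 1) → ℝ}
    (ha : a ∈ stdSimplex ℝ (Fin (m + 1))) (hb : b ∈ stdSimplex ℝ (Fin (m + 1))) :
    boxdot a b ∈ stdSimplex ℝ (Fin (m + 1)) := by
  refine ⟨fun k => Finset.sum_nonneg fun i _ => Finset.sum_nonneg fun j _ =>
    mul_nonneg (mul_nonneg (probInter_nonneg _ _ _ _) (ha.1 i)) (hb.1 j), ?_⟩
  rw [sum_boxdot, ha.2, hb.2, one_mul]

theorem toCCDF_boxdot_mono {m : ℕ} {a a' b b' : Fin (m + 1) → ℝ}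
    (ha : a ∈ stdSimplex ℝ (Fin (m + 1))) (ha' : a' ∈ stdSimplex ℝ (Fin (m + 1)))
    (hb : b ∈ stdSimplex ℝ (Fin (m + 1))) (hb' : b' ∈ stdSimplex ℝ (Fin (m + 1)))
    (haa : toCCDF a ≤ toCCDF a') (hbb : toCCDF b ≤ toCCDF b') :
    toCCDF (boxdot a b) ≤ toCCDF (boxdot a' b') := by
  intro r
  rw [toCCDF_boxdot, toCCDF_boxdot]
  calc ∑ i, a i * ∑ j, b j * interTail m i j (r + 1)
      ≤ ∑ i, a i * ∑ j, b' j * interTail m i j (r + 1) :=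
        Finset.sum_le_sum fun i _ => mul_le_mul_of_nonneg_left
          (sum_mul_le_of_toCCDF_le (hb.2.trans hb'.2.symm) hbb
            fun j j' h => interTail_mono le_rfl h _) (ha.1 i)
    _ ≤ ∑ i, a' i * ∑ j, b' j * interTail m i j (r + 1) :=
        sum_mul_le_of_toCCDF_le (ha.2.trans ha'.2.symm) haa fun i i' h =>
          Finset.sum_le_sum fun j _ => mul_le_mul_of_nonneg_left (interTail_mono h le_rfl _)
            (hb'.1 j)

theorem toCCDF_boxdot_le_left {m : ℕ} {a b : Fin (m + 1) → ℝ}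
    (ha : a ∈ stdSimplex ℝ (Fin (m + 1))) (hb : b ∈ stdSimplex ℝ (Fin (m + 1))) :
    toCCDF (boxdot a b) ≤ toCCDF a := by
  intro r
  rw [toCCDF_boxdot, toCCDF_eq_sum]
  refine Finset.sum_le_sum fun i _ => mul_le_mul_of_nonneg_left ?_ (ha.1 i)
  calc _ ≤ ∑ j, b j * (if (r : ℕ) + 1 ≤ i then 1 else 0) := Finset.sum_le_sum fun j _ =>
        mul_le_mul_of_nonneg_left (interTail_le_left i j _) (hb.1 j)
    _ = _ := by rw [← Finset.sum_mul, hb.2, one_mul]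

theorem toCCDF_boxdot_le_right {m : ℕ} {a b : Fin (m + 1) → ℝ}
    (ha : a ∈ stdSimplex ℝ (Fin (m + 1))) (hb : b ∈ stdSimplex ℝ (Fin (m + 1))) :
    toCCDF (boxdot a b) ≤ toCCDF b := by
  intro r
  rw [toCCDF_boxdot, toCCDF_eq_sum]
  calc _ ≤ ∑ i, a i * ∑ j, b j * (if (r : ℕ) + 1 ≤ j then 1 else 0) := Finset.sum_le_sum fun i _ =>
        mul_le_mul_of_nonneg_left (Finset.sum_le_sum fun j _ =>
          mul_le_mul_of_nonneg_left (interTail_le_right i j _) (hb.1 j)) (ha.1 i)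
    _ = _ := by rw [← Finset.sum_mul, ha.2, one_mul]

theorem boxdot_iterate_mem_stdSimplex {m : ℕ} {a c : Fin (m + 1) → ℝ}
    (ha : a ∈ stdSimplex ℝ (Fin (m + 1))) (hc : c ∈ stdSimplex ℝ (Fin (m + 1))) (n : ℕ) :
    (boxdot a)^[n] c ∈ stdSimplex ℝ (Fin (m + 1)) := by
  induction n with
  | zero => exact hc
  | succ n ih => rw [Function.iterate_succ_apply']; exact boxdot_mem_stdSimplex ha ih

theorem sum_boxdotPow {m : ℕ} {a : Fin (m + 1) → ℝ} (ha : ∑ k, a k = 1) (n : ℕ) :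
    ∑ k, boxdotPow a n k = 1 := by
  unfold boxdotPow
  induction n - 1 with
  | zero => exact ha
  | succ n ih => rw [Function.iterate_succ_apply', sum_boxdot, ha, ih, one_mul]

/-! ### The density-evolution updates -/

/-- The combination of `n` independent messages with CCDF vector `y` at a variable node, without a
channel observation. -/
def powCCDF {m : ℕ} (n : ℕ) (y : Fin m → ℝ) : Fin m → ℝ := toCCDF (boxdotPow (ofCCDF y) n)

theorem boxdotPow_mem_stdSimplex {m : ℕ} {y : Fin m → ℝ} (hy : y ∈ ccdfSet m) (n : ℕ) :
    boxdotPow (ofCCDF y) n ∈ stdSimplex ℝ (Fin (m + 1)) :=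
  boxdot_iterate_mem_stdSimplex (ofCCDF_mem_stdSimplex hy) (ofCCDF_mem_stdSimplex hy) _

theorem powCCDF_mem {m : ℕ} {y : Fin m → ℝ} (hy : y ∈ ccdfSet m) (n : ℕ) :
    powCCDF n y ∈ ccdfSet m := toCCDF_mem_ccdfSet (boxdotPow_mem_stdSimplex hy n)

theorem powCCDF_mono {m : ℕ} {y y' : Fin m → ℝ} (hy : y ∈ ccdfSet m) (hy' : y' ∈ ccdfSet m)
    (h : y ≤ y') (n : ℕ) : powCCDF n y ≤ powCCDF n y' := by
  unfold powCCDF boxdotPow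
  induction n - 1 with
  | zero => simpa [toCCDF_ofCCDF] using h
  | succ n ih =>
    have h1 := ofCCDF_mem_stdSimplex hy
    have h2 := ofCCDF_mem_stdSimplex hy'
    rw [Function.iterate_succ_apply', Function.iterate_succ_apply']
    exact toCCDF_boxdot_mono h1 h2 (boxdot_iterate_mem_stdSimplex h1 h1 n)
      (boxdot_iterate_mem_stdSimplex h2 h2 n) (by simpa [toCCDF_ofCCDF] using h) ih

theorem powCCDF_le {m : ℕ} {y : Fin m → ℝ} (hy : y ∈ ccdfSet m) (n : ℕ) : powCCDF n y ≤ y := by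
  unfold powCCDF boxdotPow
  have h1 := ofCCDF_mem_stdSimplex hy
  cases n - 1 with
  | zero => simp [toCCDF_ofCCDF]
  | succ n =>
    rw [Function.iterate_succ_apply']
    exact (toCCDF_boxdot_le_left h1 (boxdot_iterate_mem_stdSimplex h1 h1 n)).trans_eq
      (toCCDF_ofCCDF y)

theorem channelProb_mem {m : ℕ} {ε : ℝ} (hε : ε ∈ Icc (0 : ℝ) 1) :
    channelProb m ε ∈ stdSimplex ℝ (Fin (m + 1)) := by
  have h0 := hε.1
  have h1 : 0 ≤ 1 - ε := sub_nonneg.2 hε.2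
  refine ⟨fun k => by unfold channelProb; positivity, ?_⟩
  have := add_pow ε (1 - ε) m
  rw [add_sub_cancel, one_pow, Finset.sum_range] at this
  rw [this]
  exact Finset.sum_congr rfl fun k _ => by unfold channelProb; ring

theorem channelCCDF_mem {m : ℕ} {ε : ℝ} (hε : ε ∈ Icc (0 : ℝ) 1) : channelCCDF m ε ∈ ccdfSet m :=
  toCCDF_mem_ccdfSet (channelProb_mem hε)

theorem zero_mem_ccdfSet (m : ℕ) : (0 : Fin m → ℝ) ∈ ccdfSet m :=
  ⟨fun _ _ _ => le_rfl, fun _ => ⟨le_rfl, zero_le_one⟩⟩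

theorem domX_subset_ccdfSet {m : ℕ} {ε : ℝ} (hε : ε ∈ Icc (0 : ℝ) 1) : domX m ε ⊆ ccdfSet m :=
  fun _ hx => ⟨hx.1, fun i => ⟨(hx.2 i).1, (hx.2 i).2.trans ((channelCCDF_mem hε).2 i).2⟩⟩

theorem f_mem_domX {m dv : ℕ} {ε : ℝ} (hε : ε ∈ Icc (0 : ℝ) 1) {y : Fin m → ℝ}
    (hy : y ∈ ccdfSet m) : f dv ε y ∈ domX m ε := by
  have h1 := channelProb_mem (m := m) hε
  have h2 := boxdotPow_mem_stdSimplex hy (dv - 1)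
  have h3 : f dv ε y ∈ ccdfSet m := toCCDF_mem_ccdfSet (boxdot_mem_stdSimplex h1 h2)
  exact ⟨h3.1, fun i => ⟨(h3.2 i).1, toCCDF_boxdot_le_left h1 h2 i⟩⟩

theorem f_mono {m dv : ℕ} {ε : ℝ} (hε : ε ∈ Icc (0 : ℝ) 1) {y y' : Fin m → ℝ}
    (hy : y ∈ ccdfSet m) (hy' : y' ∈ ccdfSet m) (h : y ≤ y') : f dv ε y ≤ f dv ε y' :=
  toCCDF_boxdot_mono (channelProb_mem hε) (channelProb_mem hε) (boxdotPow_mem_stdSimplex hy _)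
    (boxdotPow_mem_stdSimplex hy' _) le_rfl (powCCDF_mono hy hy' h _)

theorem f_zero {m dv : ℕ} {ε : ℝ} (hε : ε ∈ Icc (0 : ℝ) 1) : f dv ε (0 : Fin m → ℝ) = 0 := by
  refine le_antisymm ?_ fun i => ((f_mem_domX hε (zero_mem_ccdfSet m)).2 i).1
  exact (toCCDF_boxdot_le_right (channelProb_mem hε)
    (boxdotPow_mem_stdSimplex (zero_mem_ccdfSet m) _)).trans (powCCDF_le (zero_mem_ccdfSet m) _)

/-- The involution on CCDF vectors induced by replacing each subspace by one of complementary
dimension. -/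
def compl {m : ℕ} (x : Fin m → ℝ) : Fin m → ℝ := fun i => 1 - x i.rev

theorem compl_compl {m : ℕ} (x : Fin m → ℝ) : compl (compl x) = x := by
  funext i; simp [compl]

theorem compl_mem {m : ℕ} {x : Fin m → ℝ} (hx : x ∈ ccdfSet m) : compl x ∈ ccdfSet m := by
  refine ⟨fun i j h => sub_le_sub_left (hx.1 (Fin.rev_le_rev.2 h)) 1, fun i => ⟨?_, ?_⟩⟩
  · exact sub_nonneg.2 (hx.2 _).2
  · have := (hx.2 i.rev).1
    unfold compl; linarith

theorem compl_anti {m : ℕ} {x x' : Fin m → ℝ} (h : x ≤ x') : compl x' ≤ compl x :=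
  fun i => sub_le_sub_left (h i.rev) 1

theorem toCCDF_comp_rev {m : ℕ} {a : Fin (m + 1) → ℝ} (ha : ∑ k, a k = 1) :
    toCCDF (a ∘ Fin.rev) = compl (toCCDF a) := by
  funext i
  suffices h : toCCDF (a ∘ Fin.rev) i = (∑ k, a k) - toCCDF a i.rev by rw [h, ha, compl]
  rw [toCCDF_eq_sum, toCCDF_eq_sum, ← Finset.sum_sub_distrib]
  refine Fintype.sum_equiv Fin.revPerm _ _ fun k => ?_
  simp only [Function.comp, Fin.revPerm_apply, Fin.val_rev]
  have := i.2
  have := k.2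
  split_ifs <;> first | omega | simp

theorem ofCCDF_comp_rev {m : ℕ} (x : Fin m → ℝ) : ofCCDF x ∘ Fin.rev = ofCCDF (compl x) := by
  have h := toCCDF_comp_rev (sum_ofCCDF x)
  rw [toCCDF_ofCCDF] at h
  rw [← h, ofCCDF_toCCDF]
  rw [← sum_ofCCDF x]
  exact Fintype.sum_equiv Fin.revPerm _ _ fun k => rfl

/-- The check-node update is conjugate, under complementation, to a variable-node update without
channel observation. -/
theorem g_eq {m : ℕ} (dc : ℕ) (x : Fin m → ℝ) : g dc x = compl (powCCDF (dc - 1) (compl x)) := by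
  rw [g, boxtimesPow_eq, ofCCDF_comp_rev, toCCDF_comp_rev (sum_boxdotPow (sum_ofCCDF _) _), powCCDF]

theorem g_mem {m dc : ℕ} {x : Fin m → ℝ} (hx : x ∈ ccdfSet m) : g dc x ∈ ccdfSet m := by
  rw [g_eq]; exact compl_mem (powCCDF_mem (compl_mem hx) _)

theorem g_mono {m dc : ℕ} {x x' : Fin m → ℝ} (hx : x ∈ ccdfSet m) (hx' : x' ∈ ccdfSet m)
    (h : x ≤ x') : g dc x ≤ g dc x' := by
  rw [g_eq, g_eq]
  exact compl_anti (powCCDF_mono (compl_mem hx') (compl_mem hx) (compl_anti h) _)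

theorem powCCDF_one {m : ℕ} (n : ℕ) : powCCDF n (1 : Fin m → ℝ) = 1 := by
  have h1 : ofCCDF (1 : Fin m → ℝ) = Pi.single (Fin.last m) 1 := by
    funext k
    have h := sum_ofCCDF_mul (1 : Fin m → ℝ) (Pi.single k 1)
    have h2 := sum_ite_succ_le (Pi.single k 1 : Fin (m + 1) → ℝ) (Fin.last m)
    have h3 : ∀ i : Fin m, (i : ℕ) + 1 ≤ (Fin.last m : ℕ) := fun i => i.2
    simp only [h3, if_true] at h2
    simp only [Pi.one_apply, h2] at h
    simpa [Pi.single_apply, eq_comm] using h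
  unfold powCCDF boxdotPow
  induction n - 1 with
  | zero => exact toCCDF_ofCCDF _
  | succ n ih =>
    rw [Function.iterate_succ_apply']
    refine Eq.trans ?_ ih
    funext r
    rw [toCCDF_boxdot, toCCDF_eq_sum]
    conv_lhs => rw [h1]
    simp [Pi.single_apply, interTail_last, h1]

theorem g_zero {m dc : ℕ} : g dc (0 : Fin m → ℝ) = 0 := by
  have h1 : compl (0 : Fin m → ℝ) = 1 := by funext i; simp [compl]
  rw [g_eq, h1, powCCDF_one, ← h1, compl_compl]

/-! ### Diagonalization of the variable-node combination -/

/-- The number `∏_{l < s} (2 ^ k - 2 ^ l)` of linearly independent `s`-tuples in a binary space of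
dimension `k`. -/
def indepCount (s k : ℕ) : ℝ := ∏ l ∈ Finset.range s, ((2 : ℝ) ^ k - 2 ^ l)

theorem indepCount_succ (s k : ℕ) : indepCount (s + 1) k = indepCount s k * (2 ^ k - 2 ^ s) :=
  Finset.prod_range_succ _ _

theorem indepCount_succ_succ (s k : ℕ) :
    indepCount (s + 1) (k + 1) = (2 ^ (k + 1) - 1) * 2 ^ s * indepCount s k := by
  rw [indepCount, Finset.prod_range_succ', pow_zero]
  have : ∀ l : ℕ, (2 : ℝ) ^ (k + 1) - 2 ^ (l + 1) = 2 * (2 ^ k - 2 ^ l) := fun l => by ring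
  simp_rw [this]
  rw [Finset.prod_mul_distrib, Finset.prod_const, Finset.card_range, indepCount]
  ring

theorem indepCount_eq_zero {s k : ℕ} (h : k < s) : indepCount s k = 0 :=
  Finset.prod_eq_zero (Finset.mem_range.2 h) (sub_self _)

theorem indepCount_pos {s k : ℕ} (h : s ≤ k) : 0 < indepCount s k :=
  Finset.prod_pos fun _ hl => sub_pos.2 <|
    pow_lt_pow_right₀ one_lt_two ((Finset.mem_range.1 hl).trans_le h)

/-- The linearly independent `s`-tuples in `𝔽₂ᵐ`. -/
def indepTuples (m s : ℕ) : Finset (Fin s → Fin m → ZMod 2) :=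
  open Classical in Finset.univ.filter fun τ => LinearIndependent (ZMod 2) τ

theorem mem_indepTuples {m s : ℕ} {τ : Fin s → Fin m → ZMod 2} :
    τ ∈ indepTuples m s ↔ LinearIndependent (ZMod 2) τ := by simp [indepTuples]

open Classical in
theorem card_indepTuples_filter {m s : ℕ} (W : Subsp m) :
    (((indepTuples m s).filter fun τ => ∀ l, τ l ∈ W).card : ℝ) =
      indepCount s (Module.finrank (ZMod 2) W) := by
  have hcard : ((indepTuples m s).filter fun τ => ∀ l, τ l ∈ W).card =
      Nat.card {τ : Fin s → W // LinearIndependent (ZMod 2) τ} := by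
    rw [← Fintype.card_coe, ← Nat.card_eq_fintype_card]
    refine Nat.card_congr
      { toFun := fun τ => ⟨fun l => ⟨τ.1 l, (Finset.mem_filter.1 τ.2).2 l⟩, ?_⟩
        invFun := fun τ => ⟨fun l => τ.1 l, ?_⟩
        left_inv := fun τ => rfl
        right_inv := fun τ => rfl }
    · have := mem_indepTuples.1 (Finset.mem_filter.1 τ.2).1
      exact LinearIndependent.of_comp W.subtype this
    · refine Finset.mem_filter.2 ⟨mem_indepTuples.2 ?_, fun l => (τ.1 l).2⟩
      exact τ.2.map' W.subtype W.ker_subtype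
  rw [hcard]
  rcases le_or_gt s (Module.finrank (ZMod 2) W) with h | h
  · rw [card_linearIndependent h, ZMod.card, indepCount, Finset.prod_range, Nat.cast_prod]
    refine Finset.prod_congr rfl fun l _ => ?_
    rw [Nat.cast_sub (Nat.pow_le_pow_right two_pos (l.2.le.trans h))]
    simp
  · rw [indepCount_eq_zero h, Nat.cast_eq_zero, Nat.card_eq_zero]
    left
    refine ⟨fun τ => ?_⟩
    have := τ.2.fintype_card_le_finrank
    rw [Fintype.card_fin] at this
    omega

theorem card_indepTuples (m s : ℕ) : ((indepTuples m s).card : ℝ) = indepCount s m := by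
  classical
  have := card_indepTuples_filter (m := m) (s := s) ⊤
  simpa using this

theorem exists_smul_tuple_eq {m s : ℕ} {τ τ' : Fin s → Fin m → ZMod 2}
    (h : LinearIndependent (ZMod 2) τ) (h' : LinearIndependent (ZMod 2) τ') :
    ∃ g : GLin m, g • τ = τ' := by
  obtain ⟨g, hg⟩ := Submodule.exists_linearEquiv_restrict_eq
    ((Module.Basis.span h).equiv (Module.Basis.span h') (Equiv.refl _))
  refine ⟨g, funext fun l => ?_⟩
  have := hg (Module.Basis.span h l)
  rw [Module.Basis.equiv_apply, Module.Basis.span_apply, Module.Basis.span_apply] at this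
  exact this.symm

open Classical in
/-- The number of translates of the standard `i`-dimensional space that contain a given independent
tuple does not depend on the tuple. -/
theorem sum_tuple_mem_smul_stdFlag {m s : ℕ} (hs : s ≤ m) (i : Fin (m + 1))
    {τ : Fin s → Fin m → ZMod 2} (hτ : τ ∈ indepTuples m s) :
    ∑ g : GLin m, (if ∀ l, τ l ∈ g • stdFlag m i then (1 : ℝ) else 0) =
      Fintype.card (GLin m) * indepCount s i / indepCount s m := by
  have h := card_mul_sum_smul (Γ := GLin m) (indepTuples m s)
    (fun g τ h => mem_indepTuples.2 ((mem_indepTuples.1 h).map' g.toLinearMap g.ker))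
    (fun τ h τ' h' => exists_smul_tuple_eq (mem_indepTuples.1 h) (mem_indepTuples.1 h')) hτ
    (fun τ => if ∀ l, τ l ∈ stdFlag m i then (1 : ℝ) else 0)
  rw [← Finset.sum_filter (s := indepTuples m s), Finset.sum_const, nsmul_eq_mul, mul_one,
    card_indepTuples_filter, finrank_stdFlag, card_indepTuples] at h
  have hpos := indepCount_pos hs
  rw [eq_div_iff hpos.ne', mul_comm, ← h]
  congr 1
  refine Fintype.sum_equiv (Equiv.inv _) _ _ fun g => ?_
  refine if_congr (forall_congr' fun l => ?_) rfl rfl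
  exact Submodule.mem_smul_pointwise_iff_exists _ _ _ |>.trans
    ⟨fun ⟨v, hv, e⟩ => by
      change g⁻¹ • τ l ∈ _
      rwa [← e, inv_smul_smul], fun hv => ⟨_, hv, smul_inv_smul g (τ l)⟩⟩

/-- The expected number of independent `s`-tuples in the intersection of two random subspaces is
multiplicative. -/
theorem sum_probInter_indepCount {m s : ℕ} (hs : s ≤ m) (i j : Fin (m + 1)) :
    ∑ k : Fin (m + 1), probInter m i j k * indepCount s k =
      indepCount s i * indepCount s j / indepCount s m := by
  classical
  rw [sum_probInter_mul]
  have hN := card_GLin_pos m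
  have hpos := indepCount_pos hs
  have h1 : ∀ g h : GLin m,
      indepCount s (Module.finrank (ZMod 2) (g • stdFlag m i ⊓ h • stdFlag m j : Subsp m)) =
      ∑ τ ∈ indepTuples m s, (if ∀ l, τ l ∈ g • stdFlag m i then (1 : ℝ) else 0) *
        (if ∀ l, τ l ∈ h • stdFlag m j then (1 : ℝ) else 0) := by
    intro g h
    rw [← card_indepTuples_filter, ← nsmul_one, ← Finset.sum_const, Finset.sum_filter]
    refine Finset.sum_congr rfl fun τ _ => ?_
    rw [ite_zero_mul_ite_zero, one_mul]
    refine if_congr ?_ rfl rfl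
    simp only [Submodule.mem_inf, forall_and]
  simp_rw [h1]
  have h2 : ∑ g : GLin m, ∑ h : GLin m, ∑ τ ∈ indepTuples m s,
      (if ∀ l, τ l ∈ g • stdFlag m i then (1 : ℝ) else 0) *
        (if ∀ l, τ l ∈ h • stdFlag m j then (1 : ℝ) else 0) =
      ∑ τ ∈ indepTuples m s, (∑ g : GLin m, if ∀ l, τ l ∈ g • stdFlag m i then (1 : ℝ) else 0) *
        ∑ h : GLin m, if ∀ l, τ l ∈ h • stdFlag m j then (1 : ℝ) else 0 := by
    simp_rw [Finset.sum_mul_sum]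
    rw [Finset.sum_comm (s := indepTuples m s)]
    refine Finset.sum_congr rfl fun g _ => ?_
    rw [Finset.sum_comm]
  rw [h2, Finset.sum_congr rfl fun τ hτ => by
    rw [sum_tuple_mem_smul_stdFlag hs i hτ, sum_tuple_mem_smul_stdFlag hs j hτ], Finset.sum_const,
    nsmul_eq_mul, card_indepTuples]
  field_simp

/-! ### The expected intersection dimension -/

/-- The coefficient of `indepCount (s + 1) k` in the expansion of `k`. -/
def dimCoeff (s : ℕ) : ℝ :=
  (∏ l ∈ Finset.range s, -((2 : ℝ) ^ l)⁻¹) * ((2 : ℝ) ^ s)⁻¹ / (2 ^ (s + 1) - 1)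

theorem two_pow_succ_sub_one_pos (s : ℕ) : (0 : ℝ) < 2 ^ (s + 1) - 1 :=
  sub_pos.2 (one_lt_pow₀ one_lt_two s.succ_ne_zero)

theorem dimCoeff_ne_zero (s : ℕ) : dimCoeff s ≠ 0 := by
  unfold dimCoeff
  refine div_ne_zero (mul_ne_zero (Finset.prod_ne_zero_iff.2 fun l _ => ?_) ?_)
    (two_pow_succ_sub_one_pos s).ne'
  · simp
  · simp

/-- The dimension is a linear combination of the numbers of independent tuples. -/
theorem sum_dimCoeff_mul (m k : ℕ) (hk : k ≤ m) :
    ∑ s ∈ Finset.range m, dimCoeff s * indepCount (s + 1) k = k := by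
  induction k with
  | zero =>
    rw [Nat.cast_zero]
    exact Finset.sum_eq_zero fun s _ => by rw [indepCount_eq_zero s.succ_pos, mul_zero]
  | succ k ih =>
    -- the increment of each term is a difference of consecutive values of `J`
    set J : ℕ → ℝ := fun s => (∏ l ∈ Finset.range s, -((2 : ℝ) ^ l)⁻¹) * indepCount s k with hJ
    have hstep : ∀ s, dimCoeff s * indepCount (s + 1) (k + 1) =
        dimCoeff s * indepCount (s + 1) k + (J s - J (s + 1)) := by
      intro s
      have h1 := (two_pow_succ_sub_one_pos s).ne'
      have h2 : (2 : ℝ) ^ s ≠ 0 := by positivity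
      simp only [hJ, dimCoeff]
      rw [Finset.prod_range_succ, indepCount_succ_succ, indepCount_succ]
      generalize ∏ l ∈ Finset.range s, -((2 : ℝ) ^ l)⁻¹ = u
      field_simp
      ring
    rw [Finset.sum_congr rfl fun s _ => hstep s, Finset.sum_add_distrib, ih (by omega),
      Finset.sum_range_sub']
    simp only [hJ, indepCount_eq_zero (Nat.lt_of_succ_le hk)]
    simp [indepCount]

/-- Expected dimension of the intersection of two random subspaces. -/
def meanInter (m : ℕ) (i j : Fin (m + 1)) : ℝ :=
  ∑ k : Fin (m + 1), probInter m i j k * ((k : ℕ) : ℝ)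

theorem meanInter_eq {m : ℕ} (i j : Fin (m + 1)) :
    meanInter m i j = ∑ s : Fin m, dimCoeff s / indepCount (s + 1) m *
      (indepCount (s + 1) i * indepCount (s + 1) j) := by
  unfold meanInter
  have h : ∀ k : Fin (m + 1), ((k : ℕ) : ℝ) = ∑ s : Fin m, dimCoeff s * indepCount (s + 1) k := by
    intro k
    rw [← sum_dimCoeff_mul m k (Nat.lt_succ_iff.1 k.2), Finset.sum_range]
  simp_rw [h, Finset.mul_sum]
  rw [Finset.sum_comm]
  refine Finset.sum_congr rfl fun s _ => ?_
  have := sum_probInter_indepCount (s := s + 1) s.2 i j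
  calc _ = dimCoeff s * ∑ k : Fin (m + 1), probInter m i j k * indepCount (s + 1) k := by
        rw [Finset.mul_sum]; exact Finset.sum_congr rfl fun k _ => by ring
    _ = _ := by rw [this]; ring

/-- Passing to orthogonal complements, `dim (A^⊥ ∩ B^⊥) = m - dim (A + B)`. -/
theorem meanInter_rev {m : ℕ} (i j : Fin (m + 1)) :
    meanInter m i.rev j.rev = m - i - j + meanInter m i j := by
  have hi := numSubsp_pos i
  have hj := numSubsp_pos j
  have hre : ∀ (i : Fin (m + 1)) (Ψ : Subsp m → ℝ), ∑ W ∈ subspOfDim m i.rev, Ψ W =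
      ∑ W ∈ subspOfDim m i, Ψ (orthEquiv m W) := by
    intro i Ψ
    refine (Finset.sum_equiv (orthEquiv m) (fun W => ?_) fun _ _ => rfl).symm
    rw [mem_subspOfDim, mem_subspOfDim, finrank_orthEquiv_eq_iff (Nat.lt_succ_iff.1 i.2),
      Fin.val_rev]
    simp
  have hdim : ∀ W ∈ subspOfDim m i, ∀ W' ∈ subspOfDim m j,
      (Module.finrank (ZMod 2) (orthEquiv m W ⊓ orthEquiv m W' : Subsp m) : ℝ) =
        (m - i - j) + Module.finrank (ZMod 2) (W ⊓ W' : Subsp m) := by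
    intro W hW W' hW'
    rw [mem_subspOfDim] at hW hW'
    rw [← orthEquiv_sup, finrank_orthEquiv, Nat.cast_sub (finrank_subsp_le m _)]
    have := Submodule.finrank_sup_add_finrank_inf_eq W W'
    rw [hW, hW'] at this
    have h2 : ((Module.finrank (ZMod 2) (W ⊔ W' : Subsp m) : ℕ) : ℝ) +
      (Module.finrank (ZMod 2) (W ⊓ W' : Subsp m) : ℕ) = (i : ℕ) + (j : ℕ) := by exact_mod_cast this
    linarith
  have hN : ∀ i : Fin (m + 1), numSubsp m i.rev = numSubsp m i := fun i => by
    rw [← numSubsp_sub (Nat.lt_succ_iff.1 i.2), Fin.val_rev]; simp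
  unfold meanInter
  rw [sum_probInter_mul_eq_pairs _ _ fun k => (k : ℝ),
    sum_probInter_mul_eq_pairs _ _ fun k => (k : ℝ), hre, hN, hN]
  simp_rw [hre]
  rw [Finset.sum_congr rfl fun W hW => Finset.sum_congr rfl fun W' hW' => hdim W hW W' hW']
  simp_rw [Finset.sum_add_distrib, Finset.sum_const, card_subspOfDim, nsmul_eq_mul]
  field_simp

theorem meanInter_eq_avg {m : ℕ} (i j : Fin (m + 1)) : meanInter m i j =
    (∑ g : GLin m, ∑ h : GLin m,
      (Module.finrank (ZMod 2) (g • stdFlag m i ⊓ h • stdFlag m j : Subsp m) : ℝ)) /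
      (Fintype.card (GLin m) : ℝ) ^ 2 :=
  sum_probInter_mul i j fun k => (k : ℝ)

theorem finrank_inf_add_le {m : ℕ} {A A' B B' : Subsp m} (hA : A ≤ A') (hB : B ≤ B') :
    Module.finrank (ZMod 2) (A ⊓ B' : Subsp m) + Module.finrank (ZMod 2) (A' ⊓ B : Subsp m) ≤
      Module.finrank (ZMod 2) (A' ⊓ B' : Subsp m) + Module.finrank (ZMod 2) (A ⊓ B : Subsp m) := by
  have h := Submodule.finrank_sup_add_finrank_inf_eq (A ⊓ B') (A' ⊓ B)
  have h1 : (A ⊓ B') ⊓ (A' ⊓ B) = A ⊓ B := le_antisymm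
    (le_inf (inf_le_left.trans inf_le_left) (inf_le_right.trans inf_le_right))
    (le_inf (inf_le_inf le_rfl hB) (inf_le_inf hA le_rfl))
  have h2 : (A ⊓ B') ⊔ (A' ⊓ B) ≤ A' ⊓ B' :=
    sup_le (inf_le_inf hA le_rfl) (inf_le_inf le_rfl hB)
  have h3 := Submodule.finrank_mono h2
  rw [h1] at h
  omega

/-- Strict supermodularity: the inequality of `finrank_inf_add_le` is strict if some functional
vanishes on the smaller spaces but not on the intersection of the larger ones. -/
theorem finrank_inf_add_lt {m : ℕ} {A A' B B' : Subsp m} (hA : A ≤ A') (hB : B ≤ B')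
    {φ : (Fin m → ZMod 2) →ₗ[ZMod 2] ZMod 2} (hφA : A ≤ LinearMap.ker φ)
    (hφB : B ≤ LinearMap.ker φ) {v : Fin m → ZMod 2} (hvA : v ∈ A') (hvB : v ∈ B')
    (hv : φ v ≠ 0) :
    Module.finrank (ZMod 2) (A ⊓ B' : Subsp m) + Module.finrank (ZMod 2) (A' ⊓ B : Subsp m) <
      Module.finrank (ZMod 2) (A' ⊓ B' : Subsp m) + Module.finrank (ZMod 2) (A ⊓ B : Subsp m) := by
  have h := Submodule.finrank_sup_add_finrank_inf_eq (A ⊓ B') (A' ⊓ B)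
  have h1 : (A ⊓ B') ⊓ (A' ⊓ B) = A ⊓ B := le_antisymm
    (le_inf (inf_le_left.trans inf_le_left) (inf_le_right.trans inf_le_right))
    (le_inf (inf_le_inf le_rfl hB) (inf_le_inf hA le_rfl))
  have h2 : (A ⊓ B') ⊔ (A' ⊓ B) < A' ⊓ B' := by
    refine lt_of_le_of_ne (sup_le (inf_le_inf hA le_rfl) (inf_le_inf le_rfl hB)) fun e => hv ?_
    have hle : (A ⊓ B') ⊔ (A' ⊓ B) ≤ LinearMap.ker φ :=
      sup_le (inf_le_left.trans hφA) (inf_le_right.trans hφB)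
    exact hle (e ▸ (⟨hvA, hvB⟩ : v ∈ A' ⊓ B'))
  have h3 := Submodule.finrank_lt_finrank_of_lt h2
  rw [h1] at h
  omega

/-- The mixed second difference of the expected intersection dimension is positive: it is the
probability that two random complete flags have `j ↦ i` in their relative position. -/
theorem meanInter_diff_pos {m : ℕ} (i j : Fin m) :
    0 < meanInter m i.succ j.succ - meanInter m i.castSucc j.succ -
      meanInter m i.succ j.castSucc + meanInter m i.castSucc j.castSucc := by
  have hN := card_GLin_pos m
  have hle : ∀ (i : Fin m) (g : GLin m), g • stdFlag m i.castSucc ≤ g • stdFlag m i.succ :=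
    fun i g => Submodule.map_mono (stdFlag_mono m i.castSucc_le_succ)
  have hlt : ∑ g : GLin m, ∑ h : GLin m,
      ((Module.finrank (ZMod 2) (g • stdFlag m i.castSucc ⊓ h • stdFlag m j.succ : Subsp m) : ℝ) +
        Module.finrank (ZMod 2) (g • stdFlag m i.succ ⊓ h • stdFlag m j.castSucc : Subsp m)) <
      ∑ g : GLin m, ∑ h : GLin m,
      ((Module.finrank (ZMod 2) (g • stdFlag m i.succ ⊓ h • stdFlag m j.succ : Subsp m) : ℝ) +
        Module.finrank (ZMod 2)
          (g • stdFlag m i.castSucc ⊓ h • stdFlag m j.castSucc : Subsp m)) := by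
    refine Finset.sum_lt_sum (fun g _ => Finset.sum_le_sum fun h _ => ?_)
      ⟨1, Finset.mem_univ _, Finset.sum_lt_sum (fun h _ => ?_)
        ⟨LinearEquiv.funCongrLeft (ZMod 2) (ZMod 2) (Equiv.swap i j), Finset.mem_univ _, ?_⟩⟩
    · exact_mod_cast finrank_inf_add_le (hle i g) (hle j h)
    · exact_mod_cast finrank_inf_add_le (hle i 1) (hle j h)
    · -- the standard flag and its image under the transposition of the coordinates `i` and `j`
      set σ : GLin m := LinearEquiv.funCongrLeft (ZMod 2) (ZMod 2) (Equiv.swap i j) with hσ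
      have hmem : ∀ l : Fin m, (Pi.single l 1 : Fin m → ZMod 2) ∈ stdFlag m l.succ := fun l => by
        have := (Pi.basisFun (ZMod 2) (Fin m)).self_mem_flag (i := l) (k := l.succ)
          l.castSucc_lt_succ
        rwa [Pi.basisFun_apply] at this
      have hker : ∀ l : Fin m, stdFlag m l.castSucc ≤
          LinearMap.ker (LinearMap.proj (R := ZMod 2) (φ := fun _ : Fin m => ZMod 2) l) := by
        intro l v hv
        exact (Pi.basisFun (ZMod 2) (Fin m)).flag_le_ker_coord (l := l) le_rfl hv
      have hlt := finrank_inf_add_lt (hle i 1) (hle j σ)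
        (φ := LinearMap.proj (R := ZMod 2) (φ := fun _ : Fin m => ZMod 2) i)
        (v := Pi.single i 1) ?_ ?_ ?_ ?_ ?_
      · exact_mod_cast hlt
      · rw [one_smul]; exact hker i
      · rintro _ ⟨v, hv, rfl⟩
        have := hker j hv
        simp only [LinearMap.mem_ker, LinearMap.proj_apply] at this ⊢
        change v (Equiv.swap i j i) = 0
        rw [Equiv.swap_apply_left, this]
      · rw [one_smul]; exact hmem i
      · refine ⟨Pi.single j 1, hmem j, ?_⟩
        funext l
        change (Pi.single j 1 : Fin m → ZMod 2) (Equiv.swap i j l) = _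
        simp [Pi.single_apply, Equiv.swap_apply_eq_iff]
      · simp
  simp_rw [Finset.sum_add_distrib] at hlt
  simp_rw [meanInter_eq_avg]
  rw [← sub_div, ← sub_div, ← add_div]
  exact div_pos (by linarith) (by positivity)

/-! ### Existence of the potential -/

/-- The matrix taking CCDF vectors to expected numbers of independent tuples. -/
def tupleMatrix (m : ℕ) : Matrix (Fin m) (Fin m) ℝ :=
  Matrix.of fun s i => indepCount (s + 1) (i + 1) - indepCount (s + 1) i

/-- Diagonal weights for which `tupleMatrix` diagonalizes the bilinear form of expected intersection
dimensions. -/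
def dimWeight (m : ℕ) (s : Fin m) : ℝ := dimCoeff s / indepCount (s + 1) m

/-- The bilinear form of expected intersection dimensions in CCDF coordinates. -/
def dimForm (m : ℕ) : Matrix (Fin m) (Fin m) ℝ :=
  (tupleMatrix m).transpose * Matrix.diagonal (dimWeight m) * tupleMatrix m

theorem dimForm_apply {m : ℕ} (i j : Fin m) : dimForm m i j =
    meanInter m i.succ j.succ - meanInter m i.castSucc j.succ -
      meanInter m i.succ j.castSucc + meanInter m i.castSucc j.castSucc := by
  simp_rw [meanInter_eq, ← Finset.sum_sub_distrib, ← Finset.sum_add_distrib]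
  rw [dimForm, Matrix.mul_apply]
  refine Finset.sum_congr rfl fun s _ => ?_
  rw [Matrix.mul_diagonal]
  simp only [tupleMatrix, dimWeight, Matrix.transpose_apply, Matrix.of_apply, Fin.val_succ,
    Fin.val_castSucc]
  ring

theorem dimForm_pos {m : ℕ} (i j : Fin m) : 0 < dimForm m i j := by
  rw [dimForm_apply]; exact meanInter_diff_pos i j

theorem dimForm_rev {m : ℕ} (i j : Fin m) : dimForm m i.rev j.rev = dimForm m i j := by
  rw [dimForm_apply, dimForm_apply, ← Fin.rev_castSucc, ← Fin.rev_castSucc, ← Fin.rev_succ,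
    ← Fin.rev_succ]
  simp_rw [meanInter_rev, Fin.val_succ, Fin.val_castSucc]
  push_cast
  ring

theorem dimForm_isSymm (m : ℕ) : (dimForm m).IsSymm := by
  unfold dimForm Matrix.IsSymm
  rw [Matrix.transpose_mul, Matrix.transpose_mul, Matrix.transpose_transpose,
    Matrix.diagonal_transpose, Matrix.mul_assoc]

theorem indepCount_succ_m_ne_zero {m : ℕ} (s : Fin m) : indepCount (s + 1) m ≠ 0 :=
  (indepCount_pos s.2).ne'

theorem dimForm_det_ne_zero (m : ℕ) : (dimForm m).det ≠ 0 := by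
  have hM : (tupleMatrix m).det ≠ 0 := by
    rw [Matrix.det_of_isUpperTriangular]
    · refine Finset.prod_ne_zero_iff.2 fun s _ => ?_
      rw [tupleMatrix, Matrix.of_apply, indepCount_eq_zero (Nat.lt_succ_self s), sub_zero]
      exact (indepCount_pos le_rfl).ne'
    · intro s i hi
      have hi' : (i : ℕ) < s := hi
      rw [tupleMatrix, Matrix.of_apply, indepCount_eq_zero (by omega),
        indepCount_eq_zero (by omega), sub_zero]
  rw [dimForm, Matrix.det_mul, Matrix.det_mul, Matrix.det_transpose, Matrix.det_diagonal]
  refine mul_ne_zero (mul_ne_zero hM (Finset.prod_ne_zero_iff.2 fun s _ => ?_)) hM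
  exact div_ne_zero (dimCoeff_ne_zero s) (indepCount_succ_m_ne_zero s)

theorem tupleMatrix_mulVec_toCCDF {m : ℕ} (a : Fin (m + 1) → ℝ) (s : Fin m) :
    (tupleMatrix m).mulVec (toCCDF a) s = ∑ k, a k * indepCount (s + 1) k := by
  rw [sum_mul_eq_toCCDF a fun k : Fin (m + 1) => indepCount (s + 1) k, Fin.val_zero,
    indepCount_eq_zero (Nat.succ_pos s), mul_zero, zero_add]
  simp only [Matrix.mulVec, dotProduct, tupleMatrix, Matrix.of_apply, Fin.val_succ,
    Fin.val_castSucc]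
  exact Finset.sum_congr rfl fun i _ => mul_comm _ _

theorem tupleMatrix_mulVec_boxdot {m : ℕ} (a b : Fin (m + 1) → ℝ) (s : Fin m) :
    (tupleMatrix m).mulVec (toCCDF (boxdot a b)) s =
      (tupleMatrix m).mulVec (toCCDF a) s * (tupleMatrix m).mulVec (toCCDF b) s /
        indepCount (s + 1) m := by
  simp_rw [tupleMatrix_mulVec_toCCDF]
  rw [sum_boxdot_mul a b fun k : Fin (m + 1) => indepCount (s + 1) k]
  simp_rw [sum_probInter_indepCount (s := s + 1) s.2]
  rw [Finset.sum_mul_sum, Finset.sum_div]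
  refine Finset.sum_congr rfl fun i _ => ?_
  rw [Finset.mul_sum, Finset.sum_div]
  exact Finset.sum_congr rfl fun j _ => by ring

theorem tupleMatrix_mulVec_powCCDF {m n : ℕ} (y : Fin m → ℝ) (s : Fin m) :
    (tupleMatrix m).mulVec (powCCDF (n + 1) y) s =
      (tupleMatrix m).mulVec y s ^ (n + 1) / indepCount (s + 1) m ^ n := by
  have h0 := indepCount_succ_m_ne_zero s
  unfold powCCDF boxdotPow
  rw [Nat.add_sub_cancel]
  induction n with
  | zero => simp [toCCDF_ofCCDF]
  | succ n ih =>
    rw [Function.iterate_succ_apply', tupleMatrix_mulVec_boxdot, ih, toCCDF_ofCCDF]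
    field_simp
    ring

/-- A sum of functions of the coordinates of `M y` has gradient `v Mᵀ Δ M` as soon as its partial
derivatives with respect to these coordinates form the vector `Δ M v`. -/
theorem hasFDerivAt_sum_comp_mulVec {m : ℕ} (M : Matrix (Fin m) (Fin m) ℝ) (δ : Fin m → ℝ)
    (q : Fin m → ℝ → ℝ) (y v : Fin m → ℝ)
    (hq : ∀ s, HasDerivAt (q s) (δ s * M.mulVec v s) (M.mulVec y s)) :
    HasFDerivAt (fun z => ∑ s, q s (M.mulVec z s))
      (∑ i, (Matrix.vecMul v (M.transpose * Matrix.diagonal δ * M) i) •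
        ContinuousLinearMap.proj (R := ℝ) (φ := fun _ : Fin m => ℝ) i) y := by
  have hlin : ∀ s, HasFDerivAt (fun z : Fin m → ℝ => M.mulVec z s)
      (∑ i, M s i • ContinuousLinearMap.proj (R := ℝ) (φ := fun _ : Fin m => ℝ) i) y := by
    intro s
    have := (∑ i, M s i • ContinuousLinearMap.proj (R := ℝ)
      (φ := fun _ : Fin m => ℝ) i).hasFDerivAt (x := y)
    refine this.congr_of_eventuallyEq (Filter.Eventually.of_forall fun z => ?_)
    simp [Matrix.mulVec, dotProduct]
  have h := HasFDerivAt.fun_sum (u := Finset.univ) fun s _ => (hq s).comp_hasFDerivAt y (hlin s)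
  refine h.congr_fderiv ?_
  ext w
  have e1 : ∀ s, ∑ i, M s i * w i = M.mulVec w s := fun s => rfl
  have e2 : ∑ i, Matrix.vecMul v (M.transpose * Matrix.diagonal δ * M) i * w i =
      Matrix.vecMul v (M.transpose * Matrix.diagonal δ * M) ⬝ᵥ w := rfl
  simp only [FunLike.coe_sum, FunLike.coe_smul, Finset.sum_apply, Pi.smul_apply,
    ContinuousLinearMap.proj_apply, smul_eq_mul, e1, e2]
  rw [← Matrix.vecMul_vecMul, ← Matrix.vecMul_vecMul, Matrix.vecMul_transpose,
    ← Matrix.dotProduct_mulVec]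
  simp only [dotProduct, Matrix.vecMul_diagonal]
  exact Finset.sum_congr rfl fun s _ => by ring

/-- The same form, diagonalized in the coordinates adapted to the check-node update. -/
theorem dimForm_eq_rev (m : ℕ) : dimForm m =
    ((tupleMatrix m).submatrix id Fin.rev).transpose * Matrix.diagonal (dimWeight m) *
      (tupleMatrix m).submatrix id Fin.rev := by
  ext i j
  rw [← dimForm_rev]
  simp [dimForm, Matrix.mul_apply]

theorem exists_isPotentialData (m dv dc : ℕ) (hdv : 2 ≤ dv) (hdc : 2 ≤ dc) :
    ∃ (D : Matrix (Fin m) (Fin m) ℝ) (F : (Fin m → ℝ) → ℝ → ℝ) (G : (Fin m → ℝ) → ℝ),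
      IsPotentialData dv dc D F G := by
  obtain ⟨a, rfl⟩ := Nat.exists_eq_add_of_le hdv
  obtain ⟨b, rfl⟩ := Nat.exists_eq_add_of_le hdc
  set M := tupleMatrix m with hM
  set M' := M.submatrix id Fin.rev with hM'
  set ι : Fin m → ℝ := fun s => indepCount (s + 1) m with hι
  -- antiderivatives of `Δ M f` and `Δ M' g` in the coordinates `M y` and `M' x`, in which `f` is a
  -- monomial and `g` is a monomial up to complementation
  refine ⟨dimForm m,
    fun y ε => ∑ s, dimWeight m s * (M.mulVec (channelCCDF m ε) s / ι s ^ (a + 1) *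
      (M.mulVec y s ^ (a + 2) / (a + 2 : ℕ))),
    fun x => ∑ s, dimWeight m s * (M.mulVec 1 s * M'.mulVec x s +
      ((M.mulVec 1 s - M'.mulVec x s) ^ (b + 2) - M.mulVec 1 s ^ (b + 2)) / (b + 2 : ℕ) /
        ι s ^ b),
    dimForm_isSymm m, dimForm_pos, dimForm_det_ne_zero m, ?_, ?_, ?_, ?_⟩
  · intro ε _
    simp
  · simp
  · intro ε _ y
    refine hasFDerivAt_sum_comp_mulVec M (dimWeight m) (fun s t => dimWeight m s *
      (M.mulVec (channelCCDF m ε) s / ι s ^ (a + 1) * (t ^ (a + 2) / (a + 2 : ℕ)))) y _ fun s => ?_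
    refine ((((hasDerivAt_pow (a + 2) (M.mulVec y s)).div_const _).const_mul _).const_mul
      _).congr_deriv ?_
    have h1 : M.mulVec (f (2 + a) ε y) s = M.mulVec (channelCCDF m ε) s *
        M.mulVec (powCCDF (a + 1) y) s / ι s := by
      rw [show a + 1 = 2 + a - 1 by omega]
      exact tupleMatrix_mulVec_boxdot _ _ s
    have h0 : ι s ≠ 0 := indepCount_succ_m_ne_zero s
    have ha : ((a + 2 : ℕ) : ℝ) ≠ 0 := by positivity
    rw [h1, tupleMatrix_mulVec_powCCDF, show a + 2 - 1 = a + 1 by omega]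
    change _ = dimWeight m s * (M.mulVec (channelCCDF m ε) s * (M.mulVec y s ^ (a + 1) / ι s ^ a) /
      ι s)
    field_simp
    ring
  · intro x
    rw [dimForm_eq_rev]
    refine hasFDerivAt_sum_comp_mulVec M' (dimWeight m) (fun s t => dimWeight m s *
      (M.mulVec 1 s * t + ((M.mulVec 1 s - t) ^ (b + 2) - M.mulVec 1 s ^ (b + 2)) /
        (b + 2 : ℕ) / ι s ^ b)) x _ fun s => ?_
    have hd := (((hasDerivAt_id (M'.mulVec x s)).const_mul (M.mulVec 1 s)).add
      ((((((hasDerivAt_id (M'.mulVec x s)).const_sub (M.mulVec 1 s)).pow (b + 2)).sub_const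
        (M.mulVec 1 s ^ (b + 2))).div_const ((b + 2 : ℕ) : ℝ)).div_const (ι s ^ b))).const_mul
        (dimWeight m s)
    refine hd.congr_deriv ?_
    have hrev : ∀ z : Fin m → ℝ, M'.mulVec z = M.mulVec (z ∘ Fin.rev) := by
      intro z
      funext s
      simp only [Matrix.mulVec, dotProduct, hM', Matrix.submatrix_apply, id]
      exact Fintype.sum_equiv Fin.revPerm _ _ fun i => by simp
    have hcompl : ∀ z : Fin m → ℝ, M.mulVec (compl z) s = M.mulVec 1 s - M'.mulVec z s := by
      intro z
      rw [hrev, show compl z = 1 - z ∘ Fin.rev from rfl, Matrix.mulVec_sub, Pi.sub_apply]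
    have h1 : M'.mulVec (g (2 + b) x) s = M.mulVec 1 s -
        (M.mulVec 1 s - M'.mulVec x s) ^ (b + 1) / ι s ^ b := by
      rw [← hcompl, ← tupleMatrix_mulVec_powCCDF, g_eq, show 2 + b - 1 = b + 1 by omega, ← hM]
      have := hcompl (compl (powCCDF (b + 1) (compl x)))
      rw [compl_compl] at this
      linarith
    have h0 : ι s ≠ 0 := indepCount_succ_m_ne_zero s
    have hb : ((b + 2 : ℕ) : ℝ) ≠ 0 := by positivity
    rw [h1, show b + 2 - 1 = b + 1 by omega]
    simp only [id]
    field_simp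
    ring

/-! ### Regularity of the updates and of the coupled potential -/

theorem contDiff_boxdot {E : Type*} [NormedAddCommGroup E] [NormedSpace ℝ E] {m : ℕ}
    {n : WithTop ℕ∞} {a b : E → Fin (m + 1) → ℝ} (ha : ContDiff ℝ n a) (hb : ContDiff ℝ n b) :
    ContDiff ℝ n fun x => boxdot (a x) (b x) := by
  rw [contDiff_pi] at ha hb ⊢
  intro k
  exact ContDiff.sum fun i _ => ContDiff.sum fun j _ => (contDiff_const.mul (ha i)).mul (hb j)

theorem contDiff_toCCDF {m : ℕ} {n : WithTop ℕ∞} : ContDiff ℝ n (toCCDF (m := m)) := by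
  rw [contDiff_pi]
  exact fun i => ContDiff.sum fun k _ => contDiff_apply ℝ ℝ k

theorem contDiff_ofCCDF {m : ℕ} {n : WithTop ℕ∞} : ContDiff ℝ n (ofCCDF (m := m)) := by
  rw [contDiff_pi]
  intro k
  refine ContDiff.sub ?_ ?_
  · cases k using Fin.cases with
    | zero => exact contDiff_const
    | succ k => exact contDiff_apply ℝ ℝ k
  · cases k using Fin.lastCases with
    | last => simpa using contDiff_const
    | cast k => simpa using contDiff_apply ℝ ℝ k

theorem contDiff_boxdotPow {m : ℕ} {n : WithTop ℕ∞} (N : ℕ) :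
    ContDiff ℝ n fun y : Fin m → ℝ => boxdotPow (ofCCDF y) N := by
  unfold boxdotPow
  induction N - 1 with
  | zero => exact contDiff_ofCCDF
  | succ N ih =>
    simp_rw [Function.iterate_succ_apply']
    exact contDiff_boxdot contDiff_ofCCDF ih

theorem contDiff_f {m dv : ℕ} {ε : ℝ} {n : WithTop ℕ∞} :
    ContDiff ℝ n (f dv ε : (Fin m → ℝ) → Fin m → ℝ) :=
  contDiff_toCCDF.comp (contDiff_boxdot contDiff_const (contDiff_boxdotPow _))

theorem contDiff_compl {m : ℕ} {n : WithTop ℕ∞} : ContDiff ℝ n (compl (m := m)) := by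
  rw [contDiff_pi]
  exact fun i => contDiff_const.sub (contDiff_apply ℝ ℝ i.rev)

theorem contDiff_g {m dc : ℕ} {n : WithTop ℕ∞} :
    ContDiff ℝ n (g dc : (Fin m → ℝ) → Fin m → ℝ) := by
  have h : (g dc : (Fin m → ℝ) → Fin m → ℝ) = fun x => compl (powCCDF (dc - 1) (compl x)) :=
    funext fun x => g_eq dc x
  rw [h]
  exact contDiff_compl.comp (contDiff_toCCDF.comp ((contDiff_boxdotPow _).comp contDiff_compl))

/-- A function whose gradient is `φ D` for a smooth `φ` is twice continuously differentiable. -/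
theorem contDiff_two_of_hasFDerivAt {m : ℕ} {D : Matrix (Fin m) (Fin m) ℝ} {Q : (Fin m → ℝ) → ℝ}
    {φ : (Fin m → ℝ) → Fin m → ℝ} (hφ : ContDiff ℝ 1 φ)
    (hQ : ∀ y, HasFDerivAt Q
      (∑ i, (Matrix.vecMul (φ y) D i) • ContinuousLinearMap.proj (R := ℝ) i) y) :
    ContDiff ℝ 2 Q := by
  rw [show (2 : WithTop ℕ∞) = 1 + 1 from one_add_one_eq_two.symm, contDiff_succ_iff_fderiv]
  refine ⟨fun y => (hQ y).differentiableAt, by simp, ?_⟩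
  rw [show fderiv ℝ Q = _ from funext fun y => (hQ y).fderiv]
  refine ContDiff.sum fun i _ => ContDiff.fun_smul ?_ contDiff_const
  simp only [Matrix.vecMul, dotProduct]
  exact ContDiff.sum fun j _ => ((contDiff_pi.1 hφ) j).mul contDiff_const

/-- The coupled potential on tuples of rows. -/
def chainPot {m : ℕ} (dc L w : ℕ) (D : Matrix (Fin m) (Fin m) ℝ)
    (F : (Fin m → ℝ) → ℝ → ℝ) (G : (Fin m → ℝ) → ℝ) (ε : ℝ)
    (Z : Fin (L + w - 1) → Fin m → ℝ) : ℝ :=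
  coupledPotential dc L w D F G ε (Matrix.of Z)

theorem coupling_mul_mapRows {m L w : ℕ} (φ : (Fin m → ℝ) → Fin m → ℝ)
    (X : Matrix (Fin (L + w - 1)) (Fin m) ℝ) (t : Fin L) :
    (coupling L w * mapRows φ X) t = ∑ i, coupling L w t i • φ (X i) := by
  funext b
  simp [Matrix.mul_apply, mapRows, Finset.sum_apply]

theorem coupledDE_apply {m dv dc L w : ℕ} {ε : ℝ} (X : Matrix (Fin (L + w - 1)) (Fin m) ℝ)
    (i : Fin (L + w - 1)) : coupledDE dv dc L w ε X i =
      ∑ t, coupling L w t i • f dv ε (∑ j, coupling L w t j • g dc (X j)) := by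
  simp_rw [← coupling_mul_mapRows]
  funext b
  simp [coupledDE, Matrix.mul_apply, mapRows, Finset.sum_apply]

theorem chainPot_eq {m dc L w : ℕ} {D : Matrix (Fin m) (Fin m) ℝ}
    {F : (Fin m → ℝ) → ℝ → ℝ} {G : (Fin m → ℝ) → ℝ} {ε : ℝ} (Z : Fin (L + w - 1) → Fin m → ℝ) :
    chainPot dc L w D F G ε Z = ∑ i, (g dc (Z i) ⬝ᵥ D.mulVec (Z i) - G (Z i)) -
      ∑ t, F (∑ i, coupling L w t i • g dc (Z i)) ε := by
  unfold chainPot coupledPotential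
  rw [Finset.sum_sub_distrib]
  congr 1
  · congr 1
    refine Finset.sum_congr rfl fun i _ => ?_
    rw [Matrix.dotProduct_mulVec]
    rfl
  · exact Finset.sum_congr rfl fun t _ => by rw [coupling_mul_mapRows]; rfl

section

variable {m dv dc : ℕ} {D : Matrix (Fin m) (Fin m) ℝ} {F : (Fin m → ℝ) → ℝ → ℝ}
  {G : (Fin m → ℝ) → ℝ} {ε : ℝ}

theorem contDiff_chainPot (hP : IsPotentialData dv dc D F G) (hε : ε ∈ Icc (0 : ℝ) 1) (L w : ℕ) :
    ContDiff ℝ 2 (chainPot dc L w D F G ε) := by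
  have hF := contDiff_two_of_hasFDerivAt contDiff_f (hP.F_grad ε hε)
  have hG := contDiff_two_of_hasFDerivAt contDiff_g hP.G_grad
  have hrow : ∀ i : Fin (L + w - 1), ContDiff ℝ 2 fun Z : Fin (L + w - 1) → Fin m → ℝ => Z i :=
    fun i => contDiff_apply ℝ (Fin m → ℝ) i
  have hg : ∀ i : Fin (L + w - 1), ContDiff ℝ 2
      fun Z : Fin (L + w - 1) → Fin m → ℝ => g dc (Z i) := fun i => contDiff_g.comp (hrow i)
  rw [show chainPot dc L w D F G ε = _ from funext fun Z => chainPot_eq Z]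
  refine (ContDiff.sum fun i _ => ContDiff.sub ?_ (hG.comp (hrow i))).sub
    (ContDiff.sum fun t _ => hF.comp (ContDiff.sum fun i _ => contDiff_const.fun_smul (hg i)))
  simp only [Matrix.mulVec, dotProduct]
  exact ContDiff.sum fun a _ => ((contDiff_pi.1 (hg i)) a).mul
    (ContDiff.sum fun b _ => contDiff_const.mul ((contDiff_pi.1 (hrow i)) b))

/-- The derivative of the coupled potential along a line is a sum over the rows, to which the rows
where density evolution is stationary contribute nothing. -/
theorem hasDerivAt_chainPot (hP : IsPotentialData dv dc D F G) (hε : ε ∈ Icc (0 : ℝ) 1) {L w : ℕ}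
    (Z H : Fin (L + w - 1) → Fin m → ℝ) :
    HasDerivAt (fun s : ℝ => chainPot dc L w D F G ε (Z + s • H))
      (∑ i, fderiv ℝ (g dc) (Z i) (H i) ⬝ᵥ
        D.mulVec (Z i - coupledDE dv dc L w ε (Matrix.of Z) i)) 0 := by
  set g' : Fin (L + w - 1) → Fin m → ℝ := fun i => fderiv ℝ (g dc) (Z i) (H i) with hg'
  set y : Fin L → Fin m → ℝ := fun t => ∑ i, coupling L w t i • g dc (Z i) with hy
  have hrow : ∀ i, HasDerivAt (fun s : ℝ => Z i + s • H i) (H i) 0 := fun i => by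
    simpa using ((hasDerivAt_id (0 : ℝ)).smul_const (H i)).const_add (Z i)
  have hlin : ∀ c v : Fin m → ℝ, (∑ i, c i • ContinuousLinearMap.proj (R := ℝ)
      (φ := fun _ : Fin m => ℝ) i) v = c ⬝ᵥ v := fun c v => by simp [dotProduct]
  have hz : ∀ i, Z i + (0 : ℝ) • H i = Z i := fun i => by simp
  have hg : ∀ i, HasDerivAt (fun s : ℝ => g dc (Z i + s • H i)) (g' i) 0 := fun i => by
    have h1 := ((contDiff_g (m := m) (dc := dc) (n := 1)).differentiable one_ne_zero
      (Z i)).hasFDerivAt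
    rw [← hz i] at h1
    have := h1.comp_hasDerivAt (0 : ℝ) (hrow i)
    rwa [hz i] at this
  have hGd : ∀ i, HasDerivAt (fun s : ℝ => G (Z i + s • H i)) (g dc (Z i) ⬝ᵥ D.mulVec (H i)) 0 :=
    fun i => by
      have h1 := hP.G_grad (Z i)
      rw [← hz i] at h1
      have := h1.comp_hasDerivAt (0 : ℝ) (hrow i)
      rw [hz i] at this
      refine this.congr_deriv ?_
      rw [Matrix.dotProduct_mulVec, hlin]
  have hq : ∀ i, HasDerivAt (fun s : ℝ => g dc (Z i + s • H i) ⬝ᵥ D.mulVec (Z i + s • H i))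
      (g' i ⬝ᵥ D.mulVec (Z i) + g dc (Z i) ⬝ᵥ D.mulVec (H i)) 0 := fun i => by
    have hgi := hasDerivAt_pi.1 (hg i)
    have hri := hasDerivAt_pi.1 (hrow i)
    have := HasDerivAt.fun_sum (u := Finset.univ) fun a _ => (hgi a).mul
      (HasDerivAt.fun_sum (u := Finset.univ) fun b _ => (hri b).const_mul (D a b))
    refine this.congr_deriv ?_
    simp only [hz, dotProduct, Matrix.mulVec, Finset.sum_add_distrib]
  have hFd : ∀ t, HasDerivAt (fun s : ℝ => F (∑ i, coupling L w t i • g dc (Z i + s • H i)) ε)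
      (f dv ε (y t) ⬝ᵥ D.mulVec (∑ i, coupling L w t i • g' i)) 0 := fun t => by
    have hin : HasDerivAt (fun s : ℝ => ∑ i, coupling L w t i • g dc (Z i + s • H i))
        (∑ i, coupling L w t i • g' i) 0 :=
      HasDerivAt.fun_sum fun i _ => (hg i).fun_const_smul _
    have h1 := hP.F_grad ε hε (y t)
    have hyt : y t = ∑ i, coupling L w t i • g dc (Z i + (0 : ℝ) • H i) := by simp [hy]
    rw [hyt] at h1
    have := h1.comp_hasDerivAt (0 : ℝ) hin
    rw [← hyt] at this
    refine this.congr_deriv ?_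
    rw [Matrix.dotProduct_mulVec, hlin]
  have htot := (HasDerivAt.fun_sum (u := Finset.univ) fun i _ => (hq i).sub (hGd i)).sub
    (HasDerivAt.fun_sum (u := Finset.univ) fun t _ => hFd t)
  rw [show (fun s : ℝ => chainPot dc L w D F G ε (Z + s • H)) = _ from
    funext fun s => chainPot_eq (Z + s • H)]
  refine htot.congr_deriv ?_
  have hsym : ∀ u v : Fin m → ℝ, u ⬝ᵥ D.mulVec v = v ⬝ᵥ D.mulVec u := fun u v => by
    rw [Matrix.dotProduct_mulVec, ← Matrix.mulVec_transpose, hP.symm, dotProduct_comm]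
  have hDE : ∀ i, coupledDE dv dc L w ε (Matrix.of Z) i =
    ∑ t, coupling L w t i • f dv ε (y t) := fun i => coupledDE_apply _ _
  have hlast : ∑ t, f dv ε (y t) ⬝ᵥ D.mulVec (∑ i, coupling L w t i • g' i) =
      ∑ i, g' i ⬝ᵥ D.mulVec (∑ t, coupling L w t i • f dv ε (y t)) := by
    simp_rw [Matrix.mulVec_sum, Matrix.mulVec_smul, dotProduct_sum, dotProduct_smul]
    rw [Finset.sum_comm]
    exact Finset.sum_congr rfl fun i _ => Finset.sum_congr rfl fun t _ => by rw [hsym]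
  rw [hlast, ← Finset.sum_sub_distrib]
  refine Finset.sum_congr rfl fun i _ => ?_
  rw [add_sub_cancel_right, hDE, Matrix.mulVec_sub, dotProduct_sub]

/-- A lower bound from a second-order Taylor expansion along a segment. -/
theorem le_of_second_order {E : Type*} [NormedAddCommGroup E] [NormedSpace ℝ E] {U : E → ℝ}
    (hU : ContDiff ℝ 2 U) {Z H : E} {C : ℝ} (h0 : HasDerivAt (fun s : ℝ => U (Z + s • H)) 0 0)
    (hC : ∀ s ∈ Icc (0 : ℝ) 1, |fderiv ℝ (fderiv ℝ U) (Z + s • H) H H| ≤ C) :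
    U Z - C / 2 ≤ U (Z + H) := by
  have hU1 : Differentiable ℝ U := hU.differentiable two_ne_zero
  have hU2 : Differentiable ℝ (fderiv ℝ U) :=
    (hU.fderiv_right (m := 1) (by norm_num [one_add_one_eq_two])).differentiable one_ne_zero
  have hline : ∀ s : ℝ, HasDerivAt (fun s : ℝ => Z + s • H) H s := fun s => by
    simpa using ((hasDerivAt_id s).smul_const H).const_add Z
  have h1 : ∀ s : ℝ, HasDerivAt (fun s : ℝ => U (Z + s • H)) (fderiv ℝ U (Z + s • H) H) s :=
    fun s => (hU1 _).hasFDerivAt.comp_hasDerivAt s (hline s)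
  have h2 : ∀ s : ℝ, HasDerivAt (fun s : ℝ => fderiv ℝ U (Z + s • H) H)
      (fderiv ℝ (fderiv ℝ U) (Z + s • H) H H) s := fun s => by
    have := ((hU2 _).hasFDerivAt.comp_hasDerivAt s (hline s)).clm_apply (hasDerivAt_const s H)
    simpa using this
  have hz : fderiv ℝ U (Z + (0 : ℝ) • H) H = 0 := (h1 0).unique h0
  have h3 : ∀ s : ℝ, HasDerivAt (fun s : ℝ => fderiv ℝ U (Z + s • H) H + C * s)
      (fderiv ℝ (fderiv ℝ U) (Z + s • H) H H + C) s := fun s => by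
    simpa using (h2 s).fun_add ((hasDerivAt_id s).const_mul C)
  have h4 : ∀ s : ℝ, HasDerivAt (fun s : ℝ => U (Z + s • H) + C * s ^ 2 / 2)
      (fderiv ℝ U (Z + s • H) H + C * s) s := fun s => by
    refine ((h1 s).add (((hasDerivAt_pow 2 s).const_mul C).div_const 2)).congr_deriv ?_
    simp
    ring
  have m1 : MonotoneOn (fun s : ℝ => fderiv ℝ U (Z + s • H) H + C * s) (Icc 0 1) := by
    refine monotoneOn_of_deriv_nonneg (convex_Icc 0 1)
      (fun s _ => (h3 s).continuousAt.continuousWithinAt)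
      (fun s _ => (h3 s).differentiableAt.differentiableWithinAt) fun s hs => ?_
    rw [(h3 s).deriv]
    linarith [(abs_le.1 (hC s (interior_subset hs))).1]
  have m2 : MonotoneOn (fun s : ℝ => U (Z + s • H) + C * s ^ 2 / 2) (Icc 0 1) := by
    refine monotoneOn_of_deriv_nonneg (convex_Icc 0 1)
      (fun s _ => (h4 s).continuousAt.continuousWithinAt)
      (fun s _ => (h4 s).differentiableAt.differentiableWithinAt) fun s hs => ?_
    rw [(h4 s).deriv]
    have := m1 (left_mem_Icc.2 zero_le_one) (interior_subset hs) (interior_subset hs).1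
    simp only [hz, mul_zero, add_zero] at this
    exact this
  have := m2 (left_mem_Icc.2 zero_le_one) (right_mem_Icc.2 zero_le_one) zero_le_one
  simp only [zero_smul, add_zero, one_smul] at this
  linarith

theorem sum_abs_le_normInf {ι : Type} [Fintype ι] (M : Matrix ι ι ℝ) (p : ι) :
    ∑ q, |M p q| ≤ normInf M := by
  unfold normInf
  rw [Matrix.linfty_opNorm_def]
  have h := Finset.le_sup (f := fun i => ∑ j, ‖M i j‖₊) (Finset.mem_univ p)
  have h2 : ((∑ j, ‖M p j‖₊ : NNReal) : ℝ) ≤ _ := NNReal.coe_le_coe.2 h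
  refine le_trans (le_of_eq ?_) h2
  push_cast
  rfl

/-- The second derivative along `H` is controlled by the maximal row sum of the Hessian, the sup
norm and the `ℓ¹` norm of `H`. -/
theorem abs_second_deriv_le {L w : ℕ} (X H : Fin (L + w - 1) → Fin m → ℝ) {K b c : ℝ}
    (hK : normInf (coupledHessian dc L w D F G ε (Matrix.of X)) ≤ K)
    (hb : ∀ i a, |H i a| ≤ b) (hb0 : 0 ≤ b) (hc : ∑ i, ∑ a, |H i a| ≤ c) :
    |fderiv ℝ (fderiv ℝ (chainPot dc L w D F G ε)) X H H| ≤ c * K * b := by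
  set B := fderiv ℝ (fderiv ℝ (chainPot dc L w D F G ε)) X with hB
  set M := coupledHessian dc L w D F G ε (Matrix.of X) with hM
  have hdec : H = ∑ p : Fin (L + w - 1) × Fin m, H p.1 p.2 •
      (Pi.single p.1 (Pi.single p.2 1) : Fin (L + w - 1) → Fin m → ℝ) := by
    funext i a
    rw [Fintype.sum_prod_type]
    simp [Finset.sum_apply, Pi.single_apply, Finset.sum_ite_eq, ite_apply]
  have hexp : B H H = ∑ p : Fin (L + w - 1) × Fin m, H p.1 p.2 *
      ∑ q : Fin (L + w - 1) × Fin m, H q.1 q.2 * M p q := by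
    have hM' : ∀ p q : Fin (L + w - 1) × Fin m, M p q =
        B (Pi.single p.1 (Pi.single p.2 1)) (Pi.single q.1 (Pi.single q.2 1)) := fun _ _ => rfl
    conv_lhs => rw [hdec]
    simp only [map_sum, map_smul, FunLike.coe_sum, FunLike.coe_smul, Finset.sum_apply,
      Pi.smul_apply, smul_eq_mul, hM', Finset.mul_sum]
    rw [Finset.sum_comm]
    exact Finset.sum_congr rfl fun p _ => Finset.sum_congr rfl fun q _ => by ring
  have hK0 : 0 ≤ K := by
    refine le_trans ?_ hK
    unfold normInf
    rw [Matrix.linfty_opNorm_def]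
    exact NNReal.coe_nonneg _
  rw [hexp]
  calc |∑ p : Fin (L + w - 1) × Fin m, H p.1 p.2 *
        ∑ q : Fin (L + w - 1) × Fin m, H q.1 q.2 * M p q|
      ≤ ∑ p : Fin (L + w - 1) × Fin m, |H p.1 p.2| * (K * b) := by
        refine (Finset.abs_sum_le_sum_abs _ _).trans (Finset.sum_le_sum fun p _ => ?_)
        rw [abs_mul]
        refine mul_le_mul_of_nonneg_left ?_ (abs_nonneg _)
        calc _ ≤ ∑ q, b * |M p q| := by
              refine (Finset.abs_sum_le_sum_abs _ _).trans (Finset.sum_le_sum fun q _ => ?_)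
              rw [abs_mul]
              exact mul_le_mul_of_nonneg_right (hb _ _) (abs_nonneg _)
          _ = b * ∑ q, |M p q| := (Finset.mul_sum _ _ _).symm
          _ ≤ b * K := mul_le_mul_of_nonneg_left ((sum_abs_le_normInf M p).trans hK) hb0
          _ = K * b := mul_comm _ _
    _ = (∑ i, ∑ a, |H i a|) * (K * b) := by rw [← Finset.sum_mul, Fintype.sum_prod_type]
    _ ≤ c * (K * b) := mul_le_mul_of_nonneg_right hc (mul_nonneg hK0 hb0)
    _ = c * K * b := (mul_assoc _ _ _).symm

end

/-! ### Density evolution on sequences of messages -/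

theorem sum_smul_mem_of_sum_le_one {m : ℕ} {p : Fin m → ℝ} (hp : ∀ i, 0 ≤ p i) {ι : Type*}
    {s : Finset ι} {c : ι → ℝ} {v : ι → Fin m → ℝ} (hc : ∀ t ∈ s, 0 ≤ c t)
    (hs : ∑ t ∈ s, c t ≤ 1) (hv : ∀ t ∈ s, Antitone (v t) ∧ ∀ i, 0 ≤ v t i ∧ v t i ≤ p i) :
    Antitone (∑ t ∈ s, c t • v t) ∧
      ∀ i, 0 ≤ (∑ t ∈ s, c t • v t) i ∧ (∑ t ∈ s, c t • v t) i ≤ p i := by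
  have h : ∀ i, (∑ t ∈ s, c t • v t) i = ∑ t ∈ s, c t * v t i := fun i => by
    simp [Finset.sum_apply]
  refine ⟨fun i j hij => ?_, fun i => ⟨?_, ?_⟩⟩
  · rw [h, h]
    exact Finset.sum_le_sum fun t ht => mul_le_mul_of_nonneg_left ((hv t ht).1 hij) (hc t ht)
  · rw [h]
    exact Finset.sum_nonneg fun t ht => mul_nonneg (hc t ht) ((hv t ht).2 i).1
  · rw [h]
    calc _ ≤ ∑ t ∈ s, c t * p i :=
          Finset.sum_le_sum fun t ht => mul_le_mul_of_nonneg_left ((hv t ht).2 i).2 (hc t ht)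
      _ = (∑ t ∈ s, c t) * p i := (Finset.sum_mul _ _ _).symm
      _ ≤ 1 * p i := mul_le_mul_of_nonneg_right hs (hp i)
      _ = p i := one_mul _

theorem zero_mem_domX {m : ℕ} {ε : ℝ} (hε : ε ∈ Icc (0 : ℝ) 1) : (0 : Fin m → ℝ) ∈ domX m ε :=
  ⟨fun _ _ _ => le_rfl, fun i => ⟨le_rfl, ((channelCCDF_mem hε).2 i).1⟩⟩

/-- The sum of the `a t` over the rows `t < L` of the coupling matrix that involve column `i`. -/
def windowSum {E : Type*} [AddCommMonoid E] (L w : ℕ) (a : ℕ → E) (i : ℕ) : E :=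
  ∑ t ∈ Finset.range L, if t ≤ i ∧ i < t + w then a t else 0

theorem windowSum_apply {m : ℕ} (L w : ℕ) (a : ℕ → Fin m → ℝ) (i : ℕ) (b : Fin m) :
    windowSum L w a i b = windowSum L w (fun t => a t b) i := by
  unfold windowSum
  rw [Finset.sum_apply]
  exact Finset.sum_congr rfl fun t _ => by split_ifs <;> rfl

theorem windowSum_one_le (L w i : ℕ) : windowSum L w (fun _ => (1 : ℝ)) i ≤ w := by
  unfold windowSum
  rw [← Finset.sum_filter, Finset.sum_const, nsmul_eq_mul, mul_one, Nat.cast_le]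
  calc _ ≤ (Finset.Ico (i + 1 - w) (i + 1)).card := by
        refine Finset.card_le_card fun t ht => ?_
        rw [Finset.mem_filter] at ht
        rw [Finset.mem_Ico]
        omega
    _ ≤ w := by rw [Nat.card_Ico]; omega

theorem windowSum_mono {L w : ℕ} {a b : ℕ → ℝ} (h : ∀ t, a t ≤ b t) (i : ℕ) :
    windowSum L w a i ≤ windowSum L w b i :=
  Finset.sum_le_sum fun t _ => by split_ifs <;> simp [h]

theorem windowSum_zero {L w : ℕ} (hL : 1 ≤ L) (hw : 1 ≤ w) (a : ℕ → ℝ) :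
    windowSum L w a 0 = a 0 := by
  unfold windowSum
  rw [Finset.sum_eq_single_of_mem 0 (Finset.mem_range.2 hL), if_pos ⟨le_rfl, by omega⟩]
  intro t _ ht
  exact if_neg (by omega)

theorem windowSum_succ {L w : ℕ} (hw : 1 ≤ w) (a : ℕ → ℝ) (i : ℕ) :
    windowSum L w a (i + 1) = windowSum L w a i + (if i + 1 < L then a (i + 1) else 0) -
      (if w ≤ i + 1 ∧ i + 1 - w < L then a (i + 1 - w) else 0) := by
  have h1 : (if i + 1 < L then a (i + 1) else 0) =
      ∑ t ∈ Finset.range L, if t = i + 1 then a t else 0 := by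
    rw [Finset.sum_ite_eq' (Finset.range L) (i + 1) a]
    simp only [Finset.mem_range]
  have h2 : (if w ≤ i + 1 ∧ i + 1 - w < L then a (i + 1 - w) else 0) =
      ∑ t ∈ Finset.range L, if t + w = i + 1 then a t else 0 := by
    by_cases hwi : w ≤ i + 1
    · have : ∀ t, t + w = i + 1 ↔ t = i + 1 - w := fun t => by omega
      simp_rw [this]
      rw [Finset.sum_ite_eq' (Finset.range L) (i + 1 - w) a]
      simp [hwi]
    · rw [if_neg (by tauto)]
      exact (Finset.sum_eq_zero fun t _ => if_neg (by omega)).symm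
  rw [h1, h2]
  unfold windowSum
  rw [← Finset.sum_add_distrib, ← Finset.sum_sub_distrib]
  refine Finset.sum_congr rfl fun t _ => ?_
  split_ifs <;> first | omega | simp

/-- Up to the middle of the chain, a window that loses a row also gains a later one. -/
theorem windowSum_le_succ {L w : ℕ} (hw : 1 ≤ w) {a : ℕ → ℝ} (ha : Monotone a)
    (h0 : ∀ t, 0 ≤ a t) {i : ℕ} (hi : i + 1 ≤ (L + w - 2) / 2) :
    windowSum L w a i ≤ windowSum L w a (i + 1) := by
  rw [windowSum_succ hw]
  have := ha (Nat.sub_le (i + 1) w)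
  have := h0 (i + 1)
  split_ifs <;> first | omega | linarith

theorem windowSum_succ_le {L w : ℕ} (hw : 1 ≤ w) {a : ℕ → ℝ} (h0 : ∀ t, 0 ≤ a t)
    (h1 : ∀ t, a t ≤ 1) (i : ℕ) : windowSum L w a (i + 1) ≤ windowSum L w a i + 1 := by
  rw [windowSum_succ hw]
  have := h0 (i + 1 - w)
  have := h1 (i + 1)
  split_ifs <;> linarith

theorem sum_coupling_row {E : Type*} [AddCommGroup E] [Module ℝ E] {L w : ℕ}
    (v : ℕ → E) (t : Fin L) : ∑ i : Fin (L + w - 1), coupling L w t i • v i =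
      (w : ℝ)⁻¹ • ∑ k ∈ Finset.range w, v (t + k) := by
  have h := t.2
  calc _ = ∑ i ∈ Finset.range (L + w - 1),
        (if (t : ℕ) ≤ i ∧ i < t + w then 1 / (w : ℝ) else 0) • v i := by
        rw [Finset.sum_range]; rfl
    _ = ∑ i ∈ Finset.Ico (t : ℕ) (t + w), (w : ℝ)⁻¹ • v i := by
        simp_rw [ite_smul, zero_smul, one_div]
        rw [← Finset.sum_filter]
        refine Finset.sum_congr ?_ fun _ _ => rfl
        ext i
        simp only [Finset.mem_filter, Finset.mem_range, Finset.mem_Ico]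
        omega
    _ = _ := by
        rw [Finset.sum_Ico_eq_sum_range, Finset.smul_sum, Nat.add_sub_cancel_left]

theorem sum_coupling_col {E : Type*} [AddCommGroup E] [Module ℝ E] {L w : ℕ}
    (a : ℕ → E) (i : Fin (L + w - 1)) : ∑ t : Fin L, coupling L w t i • a t =
      (w : ℝ)⁻¹ • windowSum L w a i := by
  unfold windowSum
  rw [Finset.smul_sum, Finset.sum_range]
  refine Finset.sum_congr rfl fun t _ => ?_
  simp only [coupling, Matrix.of_apply, one_div]
  split_ifs <;> simp

section Sequences

variable {m : ℕ} (dv dc L w : ℕ) (ε : ℝ)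

/-- The message `(A G(X))_t` when the rows of `X` are the terms of a sequence. -/
def seqMessage (x : ℕ → Fin m → ℝ) (t : ℕ) : Fin m → ℝ :=
  (w : ℝ)⁻¹ • ∑ k ∈ Finset.range w, g dc (x (t + k))

/-- Coupled density evolution when the rows of `X` are the terms of a sequence. -/
def seqDE (x : ℕ → Fin m → ℝ) (i : ℕ) : Fin m → ℝ :=
  (w : ℝ)⁻¹ • windowSum L w (fun t => f dv ε (seqMessage dc w x t)) i

/-- One-sided density evolution: the positions beyond the middle of the chain copy the middle. -/
def oneSidedDE (x : ℕ → Fin m → ℝ) (k : ℕ) : Fin m → ℝ :=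
  seqDE dv dc L w ε x (min k ((L + w - 2) / 2))

/-- The matrix whose rows are the terms of a sequence. -/
def seqMat (x : ℕ → Fin m → ℝ) : Matrix (Fin (L + w - 1)) (Fin m) ℝ := Matrix.of fun i => x i

/-- Sequences in `domX` that increase along the chain. -/
def incSeqs (m : ℕ) (ε : ℝ) : Set (ℕ → Fin m → ℝ) := {x | Monotone x ∧ ∀ k, x k ∈ domX m ε}

variable {dv dc L w ε}

theorem sum_coupling_g (x : ℕ → Fin m → ℝ) (t : Fin L) :
    ∑ i : Fin (L + w - 1), coupling L w t i • g dc (seqMat L w x i) = seqMessage dc w x t :=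
  sum_coupling_row (fun i => g dc (x i)) t

theorem coupledDE_seqMat (x : ℕ → Fin m → ℝ) (i : Fin (L + w - 1)) :
    coupledDE dv dc L w ε (seqMat L w x) i = seqDE dv dc L w ε x i := by
  rw [coupledDE_apply]
  simp_rw [sum_coupling_g]
  exact sum_coupling_col (fun t => f dv ε (seqMessage dc w x t)) i

theorem sum_coupling_row_eq_one (hw : 1 ≤ w) (t : Fin L) :
    ∑ i : Fin (L + w - 1), coupling L w t i = 1 := by
  have := sum_coupling_row (w := w) (fun _ => (1 : ℝ)) t
  have hw' : (w : ℝ) ≠ 0 := Nat.cast_ne_zero.2 (by omega)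
  simpa [hw'] using this

theorem sum_coupling_col_le_one (hw : 1 ≤ w) (i : Fin (L + w - 1)) :
    ∑ t : Fin L, coupling L w t i ≤ 1 := by
  have h := sum_coupling_col (w := w) (fun _ => (1 : ℝ)) i
  have hw' : (0 : ℝ) < w := Nat.cast_pos.2 (by omega)
  simp only [smul_eq_mul, mul_one] at h
  rw [h, inv_mul_le_iff₀ hw', mul_one]
  exact windowSum_one_le L w i

theorem coupling_nonneg (t : Fin L) (i : Fin (L + w - 1)) : 0 ≤ coupling L w t i := by
  simp only [coupling, Matrix.of_apply]
  split_ifs <;> positivity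

theorem sum_coupling_g_mem (hw : 1 ≤ w) {X : Fin (L + w - 1) → Fin m → ℝ}
    (hX : ∀ i, X i ∈ ccdfSet m) (t : Fin L) : ∑ i, coupling L w t i • g dc (X i) ∈ ccdfSet m :=
  sum_smul_mem_of_sum_le_one (fun _ => zero_le_one) (fun i _ => coupling_nonneg t i)
    (sum_coupling_row_eq_one hw t).le fun i _ => g_mem (hX i)

theorem coupledDE_mem (hε : ε ∈ Icc (0 : ℝ) 1) (hw : 1 ≤ w)
    {X : Matrix (Fin (L + w - 1)) (Fin m) ℝ} (hX : X ∈ coupledDom m L w ε) :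
    coupledDE dv dc L w ε X ∈ coupledDom m L w ε := by
  intro i
  rw [coupledDE_apply]
  exact sum_smul_mem_of_sum_le_one (fun i => ((channelCCDF_mem hε).2 i).1)
    (fun t _ => coupling_nonneg t i) (sum_coupling_col_le_one hw i) fun t _ =>
      f_mem_domX hε (sum_coupling_g_mem hw (fun i => domX_subset_ccdfSet hε (hX i)) t)

theorem coupledDE_mono (hε : ε ∈ Icc (0 : ℝ) 1) (hw : 1 ≤ w)
    {X Y : Matrix (Fin (L + w - 1)) (Fin m) ℝ} (hX : X ∈ coupledDom m L w ε)
    (hY : Y ∈ coupledDom m L w ε) (h : ∀ i, X i ≤ Y i) (i : Fin (L + w - 1)) :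
    coupledDE dv dc L w ε X i ≤ coupledDE dv dc L w ε Y i := by
  have hX' := fun i => domX_subset_ccdfSet hε (hX i)
  have hY' := fun i => domX_subset_ccdfSet hε (hY i)
  rw [coupledDE_apply, coupledDE_apply]
  exact Finset.sum_le_sum fun t _ => smul_le_smul_of_nonneg_left
    (f_mono hε (sum_coupling_g_mem hw hX' t) (sum_coupling_g_mem hw hY' t)
      (Finset.sum_le_sum fun j _ => smul_le_smul_of_nonneg_left (g_mono (hX' j) (hY' j) (h j))
        (coupling_nonneg t j))) (coupling_nonneg t i)

theorem coupling_rev (t : Fin L) (i : Fin (L + w - 1)) :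
    coupling L w t.rev i.rev = coupling L w t i := by
  simp only [coupling, Matrix.of_apply, Fin.val_rev]
  have := t.2
  have := i.2
  exact if_congr (by omega) rfl rfl

/-- Density evolution commutes with the reflection of the chain. -/
theorem coupledDE_rev (X : Matrix (Fin (L + w - 1)) (Fin m) ℝ) (i : Fin (L + w - 1)) :
    coupledDE dv dc L w ε (X.submatrix Fin.rev id) i = coupledDE dv dc L w ε X i.rev := by
  rw [coupledDE_apply, coupledDE_apply]
  refine Fintype.sum_equiv Fin.revPerm _ _ fun t => ?_
  rw [Fin.revPerm_apply, coupling_rev]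
  congr 2
  refine Fintype.sum_equiv Fin.revPerm _ _ fun j => ?_
  rw [Fin.revPerm_apply, coupling_rev]
  congr 2

theorem seqMessage_mem (hw : 1 ≤ w) {x : ℕ → Fin m → ℝ} (hx : ∀ k, x k ∈ ccdfSet m) (t : ℕ) :
    seqMessage dc w x t ∈ ccdfSet m := by
  have hw' : (w : ℝ) ≠ 0 := Nat.cast_ne_zero.2 (by omega)
  unfold seqMessage
  rw [Finset.smul_sum]
  refine sum_smul_mem_of_sum_le_one (fun _ => zero_le_one) (fun _ _ => by positivity) ?_
    fun k _ => g_mem (hx _)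
  simp [hw']

theorem seqMessage_mono (hw : 1 ≤ w) {x y : ℕ → Fin m → ℝ} (hx : ∀ k, x k ∈ ccdfSet m)
    (hy : ∀ k, y k ∈ ccdfSet m) {t u : ℕ} (h : ∀ k, x (t + k) ≤ y (u + k)) :
    seqMessage dc w x t ≤ seqMessage dc w y u :=
  smul_le_smul_of_nonneg_left (Finset.sum_le_sum fun k _ => g_mono (hx _) (hy _) (h k))
    (by positivity)

theorem seqMessage_le (hw : 1 ≤ w) {x : ℕ → Fin m → ℝ} (hx : ∀ k, x k ∈ ccdfSet m)
    {z : Fin m → ℝ} (hz : z ∈ ccdfSet m) (h : ∀ k, x k ≤ z) (t : ℕ) :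
    seqMessage dc w x t ≤ g dc z := by
  have hw' : (w : ℝ) ≠ 0 := Nat.cast_ne_zero.2 (by omega)
  refine (seqMessage_mono hw hx (y := fun _ => z) (fun _ => hz) (u := 0) fun k => h _).trans_eq ?_
  unfold seqMessage
  rw [Finset.sum_const, Finset.card_range, ← Nat.cast_smul_eq_nsmul ℝ, smul_smul,
    inv_mul_cancel₀ hw', one_smul]

theorem seqDE_mem (hε : ε ∈ Icc (0 : ℝ) 1) (hw : 1 ≤ w) {x : ℕ → Fin m → ℝ}
    (hx : ∀ k, x k ∈ domX m ε) (i : ℕ) : seqDE dv dc L w ε x i ∈ domX m ε := by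
  have hw' : (0 : ℝ) < w := Nat.cast_pos.2 (by omega)
  have hx' := fun k => domX_subset_ccdfSet hε (hx k)
  have h : seqDE dv dc L w ε x i = ∑ t ∈ Finset.range L,
      ((w : ℝ)⁻¹ * if t ≤ i ∧ i < t + w then 1 else 0) • f dv ε (seqMessage dc w x t) := by
    unfold seqDE windowSum
    rw [Finset.smul_sum]
    exact Finset.sum_congr rfl fun t _ => by split_ifs <;> simp
  rw [h]
  refine sum_smul_mem_of_sum_le_one (fun i => ((channelCCDF_mem hε).2 i).1)
    (fun t _ => by split_ifs <;> simp) ?_ fun t _ => f_mem_domX hε (seqMessage_mem hw hx' t)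
  rw [← Finset.mul_sum, inv_mul_le_iff₀ hw', mul_one]
  exact windowSum_one_le L w i

theorem seqDE_apply (x : ℕ → Fin m → ℝ) (i : ℕ) (b : Fin m) : seqDE dv dc L w ε x i b =
    (w : ℝ)⁻¹ * windowSum L w (fun t => f dv ε (seqMessage dc w x t) b) i := by
  rw [seqDE, Pi.smul_apply, windowSum_apply, smul_eq_mul]

theorem seqDE_mono (hε : ε ∈ Icc (0 : ℝ) 1) (hw : 1 ≤ w) {x y : ℕ → Fin m → ℝ}
    (hx : ∀ k, x k ∈ domX m ε) (hy : ∀ k, y k ∈ domX m ε) (h : x ≤ y) (i : ℕ) :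
    seqDE dv dc L w ε x i ≤ seqDE dv dc L w ε y i := by
  have hx' := fun k => domX_subset_ccdfSet hε (hx k)
  have hy' := fun k => domX_subset_ccdfSet hε (hy k)
  intro b
  rw [seqDE_apply, seqDE_apply]
  exact mul_le_mul_of_nonneg_left (windowSum_mono (fun t => f_mono hε (seqMessage_mem hw hx' t)
    (seqMessage_mem hw hy' t) (seqMessage_mono hw hx' hy' fun k => h _) b) i) (by positivity)

theorem seqDE_le_succ (hε : ε ∈ Icc (0 : ℝ) 1) (hw : 1 ≤ w) {x : ℕ → Fin m → ℝ}
    (hx : x ∈ incSeqs m ε) {i : ℕ} (hi : i + 1 ≤ (L + w - 2) / 2) :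
    seqDE dv dc L w ε x i ≤ seqDE dv dc L w ε x (i + 1) := by
  have hx' := fun k => domX_subset_ccdfSet hε (hx.2 k)
  intro b
  rw [seqDE_apply, seqDE_apply]
  refine mul_le_mul_of_nonneg_left (windowSum_le_succ hw (fun t u htu => ?_) (fun t => ?_) hi)
    (by positivity)
  · exact f_mono hε (seqMessage_mem hw hx' t) (seqMessage_mem hw hx' u)
      (seqMessage_mono hw hx' hx' fun k => hx.1 (by omega)) b
  · exact ((f_mem_domX hε (seqMessage_mem hw hx' t)).2 b).1

theorem seqDE_succ_le (hε : ε ∈ Icc (0 : ℝ) 1) (hw : 1 ≤ w) {x : ℕ → Fin m → ℝ}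
    (hx : ∀ k, x k ∈ domX m ε) (i : ℕ) (b : Fin m) :
    seqDE dv dc L w ε x (i + 1) b ≤ seqDE dv dc L w ε x i b + 1 / w := by
  have hx' := fun k => domX_subset_ccdfSet hε (hx k)
  have hf := fun t => (domX_subset_ccdfSet hε (f_mem_domX (dv := dv) hε
    (seqMessage_mem (dc := dc) hw hx' t))).2 b
  rw [seqDE_apply, seqDE_apply, one_div, ← mul_add_one]
  exact mul_le_mul_of_nonneg_left (windowSum_succ_le hw (fun t => (hf t).1) (fun t => (hf t).2) i)
    (by positivity)

theorem seqDE_zero_le (hε : ε ∈ Icc (0 : ℝ) 1) (hL : 1 ≤ L) (hw : 1 ≤ w) {x : ℕ → Fin m → ℝ}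
    (hx : ∀ k, x k ∈ domX m ε) (b : Fin m) : seqDE dv dc L w ε x 0 b ≤ 1 / w := by
  have hx' := fun k => domX_subset_ccdfSet hε (hx k)
  rw [seqDE_apply, windowSum_zero hL hw, one_div]
  exact mul_le_of_le_one_right (by positivity) ((domX_subset_ccdfSet hε (f_mem_domX (dv := dv) hε
    (seqMessage_mem (dc := dc) hw hx' 0))).2 b).2

theorem seqDE_le (hε : ε ∈ Icc (0 : ℝ) 1) (hw : 1 ≤ w) {x : ℕ → Fin m → ℝ}
    (hx : ∀ k, x k ∈ domX m ε) {z : Fin m → ℝ} (hz : z ∈ domX m ε) (h : ∀ k, x k ≤ z) (i : ℕ) :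
    seqDE dv dc L w ε x i ≤ f dv ε (g dc z) := by
  have hw' : (0 : ℝ) < w := Nat.cast_pos.2 (by omega)
  have hx' := fun k => domX_subset_ccdfSet hε (hx k)
  have hz' := domX_subset_ccdfSet hε hz
  intro b
  rw [seqDE_apply, inv_mul_le_iff₀ hw']
  set z' := f dv ε (g dc z) b with hzb
  have hz0 : 0 ≤ z' := ((f_mem_domX hε (g_mem hz')).2 b).1
  calc _ ≤ windowSum L w (fun _ => z') i := windowSum_mono (fun t =>
        f_mono hε (seqMessage_mem hw hx' t) (g_mem hz') (seqMessage_le hw hx' hz' h t) b) i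
    _ = windowSum L w (fun _ => (1 : ℝ)) i * z' := by
        unfold windowSum
        rw [Finset.sum_mul]
        exact Finset.sum_congr rfl fun t _ => by split_ifs <;> simp
    _ ≤ w * z' := mul_le_mul_of_nonneg_right (windowSum_one_le L w i) hz0

/-! ### The one-sided system -/

theorem oneSidedDE_mem (hε : ε ∈ Icc (0 : ℝ) 1) (hw : 1 ≤ w) {x : ℕ → Fin m → ℝ}
    (hx : x ∈ incSeqs m ε) : oneSidedDE dv dc L w ε x ∈ incSeqs m ε := by
  refine ⟨monotone_nat_of_le_succ fun k => ?_, fun k => seqDE_mem hε hw hx.2 _⟩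
  unfold oneSidedDE
  rcases le_or_gt (k + 1) ((L + w - 2) / 2) with h | h
  · rw [min_eq_left h, min_eq_left (by omega)]
    exact seqDE_le_succ hε hw hx h
  · rw [min_eq_right h.le, min_eq_right (by omega)]

theorem oneSidedDE_mono (hε : ε ∈ Icc (0 : ℝ) 1) (hw : 1 ≤ w) {x y : ℕ → Fin m → ℝ}
    (hx : x ∈ incSeqs m ε) (hy : y ∈ incSeqs m ε) (h : x ≤ y) :
    oneSidedDE dv dc L w ε x ≤ oneSidedDE dv dc L w ε y :=
  fun _ => seqDE_mono hε hw hx.2 hy.2 h _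

/-- Density evolution is dominated by the one-sided system, on both halves of the chain. -/
theorem coupledDE_le_oneSidedDE (hε : ε ∈ Icc (0 : ℝ) 1) (hw : 1 ≤ w)
    {X : Matrix (Fin (L + w - 1)) (Fin m) ℝ} (hX : X ∈ coupledDom m L w ε)
    {x : ℕ → Fin m → ℝ} (hx : x ∈ incSeqs m ε) (h : ∀ i : Fin (L + w - 1), X i ≤ x i)
    (h' : ∀ i : Fin (L + w - 1), X i.rev ≤ x i)
    (i : Fin (L + w - 1)) : coupledDE dv dc L w ε X i ≤ oneSidedDE dv dc L w ε x i := by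
  have hxm : seqMat L w x ∈ coupledDom m L w ε := fun i => hx.2 i
  have hXr : X.submatrix Fin.rev id ∈ coupledDom m L w ε := fun i => hX i.rev
  rcases le_or_gt (i : ℕ) ((L + w - 2) / 2) with hi | hi
  · refine (coupledDE_mono hε hw hX hxm h i).trans_eq ?_
    rw [coupledDE_seqMat, oneSidedDE, min_eq_left hi]
  · have hir : (i.rev : ℕ) ≤ (L + w - 2) / 2 := by rw [Fin.val_rev]; omega
    have h1 := coupledDE_mono (dv := dv) (dc := dc) hε hw hXr hxm h' i.rev
    rw [coupledDE_rev, Fin.rev_rev, coupledDE_seqMat] at h1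
    refine h1.trans ?_
    have h2 := (oneSidedDE_mem (dv := dv) (dc := dc) (L := L) hε hw hx).1 (hir.trans hi.le)
    refine le_trans (le_of_eq ?_) h2
    rw [oneSidedDE, min_eq_left hir]

/-- The orbits of density evolution stay below those of the one-sided system. Beyond the middle of
the chain the comparison is with the mirror position, hence the second bound. -/
theorem iterate_coupledDE_le (hε : ε ∈ Icc (0 : ℝ) 1) (hw : 1 ≤ w)
    {X : Matrix (Fin (L + w - 1)) (Fin m) ℝ} (hX : X ∈ coupledDom m L w ε)
    {x : ℕ → Fin m → ℝ} (hx : x ∈ incSeqs m ε) (h : ∀ i k, X i ≤ x k) (n : ℕ) :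
    (coupledDE dv dc L w ε)^[n] X ∈ coupledDom m L w ε ∧
      (oneSidedDE dv dc L w ε)^[n] x ∈ incSeqs m ε ∧
      ∀ i : Fin (L + w - 1),
        (coupledDE dv dc L w ε)^[n] X i ≤ (oneSidedDE dv dc L w ε)^[n] x i ∧
        (coupledDE dv dc L w ε)^[n] X i.rev ≤ (oneSidedDE dv dc L w ε)^[n] x i := by
  induction n with
  | zero => exact ⟨hX, hx, fun i => ⟨h i i, h i.rev i⟩⟩
  | succ n ih =>
    obtain ⟨h1, h2, h3⟩ := ih
    simp only [Function.iterate_succ_apply']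
    refine ⟨coupledDE_mem hε hw h1, oneSidedDE_mem hε hw h2, fun i => ⟨?_, ?_⟩⟩
    · exact coupledDE_le_oneSidedDE hε hw h1 h2 (fun i => (h3 i).1) (fun i => (h3 i).2) i
    · have h1r : ((coupledDE dv dc L w ε)^[n] X).submatrix Fin.rev id ∈ coupledDom m L w ε :=
        fun i => h1 i.rev
      have := coupledDE_le_oneSidedDE (dv := dv) (dc := dc) hε hw h1r h2 (fun i => (h3 i).2)
        (fun i => (congrArg (fun j => (coupledDE dv dc L w ε)^[n] X j) (Fin.rev_rev i)).trans_le
          (h3 i).1) i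
      rwa [coupledDE_rev] at this

theorem continuous_oneSidedDE :
    Continuous (oneSidedDE dv dc L w ε : (ℕ → Fin m → ℝ) → ℕ → Fin m → ℝ) := by
  have hf : Continuous (f dv ε : (Fin m → ℝ) → Fin m → ℝ) := (contDiff_f (n := 0)).continuous
  have hg : Continuous (g dc : (Fin m → ℝ) → Fin m → ℝ) := (contDiff_g (n := 0)).continuous
  have hy : ∀ t, Continuous fun x : ℕ → Fin m → ℝ => seqMessage dc w x t := fun t =>
    Continuous.const_smul (continuous_finsetSum (Finset.range w) fun j _ =>
      hg.comp (continuous_apply (t + j))) (w : ℝ)⁻¹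
  have hs : ∀ i, Continuous fun x : ℕ → Fin m → ℝ => seqDE dv dc L w ε x i := fun i => by
    unfold seqDE windowSum
    refine Continuous.const_smul (continuous_finsetSum (Finset.range L) fun t _ => ?_) (w : ℝ)⁻¹
    split_ifs
    · exact hf.comp (hy t)
    · exact continuous_const
  exact continuous_pi fun k => hs _

theorem channel_mem_incSeqs (hε : ε ∈ Icc (0 : ℝ) 1) :
    (fun _ => channelCCDF m ε : ℕ → Fin m → ℝ) ∈ incSeqs m ε :=
  ⟨fun _ _ _ => le_rfl, fun _ => ⟨(channelCCDF_mem hε).1,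
    fun i => ⟨((channelCCDF_mem hε).2 i).1, le_rfl⟩⟩⟩

/-- The one-sided system started from the channel decreases to a fixed point. -/
theorem exists_tendsto_oneSidedDE (hε : ε ∈ Icc (0 : ℝ) 1) (hw : 1 ≤ w) :
    ∃ x ∈ incSeqs m ε, oneSidedDE dv dc L w ε x = x ∧
      Tendsto (fun n : ℕ => (oneSidedDE dv dc L w ε)^[n] fun _ => channelCCDF m ε) atTop
        (𝓝 x) := by
  set P : ℕ → Fin m → ℝ := fun _ => channelCCDF m ε with hP
  set T : (ℕ → Fin m → ℝ) → ℕ → Fin m → ℝ := oneSidedDE dv dc L w ε with hT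
  have hmem : ∀ n, T^[n] P ∈ incSeqs m ε := by
    intro n
    induction n with
    | zero => exact channel_mem_incSeqs hε
    | succ n ih => rw [Function.iterate_succ_apply']; exact oneSidedDE_mem hε hw ih
  have hanti : Antitone fun n => T^[n] P := by
    refine antitone_nat_of_succ_le fun n => ?_
    induction n with
    | zero =>
      intro k i
      exact (((hmem 1).2 k).2 i).2
    | succ n ih =>
      have h : T (T^[n + 1] P) ≤ T (T^[n] P) :=
        oneSidedDE_mono hε hw (hmem (n + 1)) (hmem n) ih
      rwa [← Function.iterate_succ_apply' T, ← Function.iterate_succ_apply' T] at h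
  have hlim : ∀ k i, ∃ l, Tendsto (fun n => (T^[n] P) k i) atTop (𝓝 l) := fun k i =>
    ⟨_, tendsto_atTop_ciInf (fun a b hab => hanti hab k i)
      ⟨0, by rintro _ ⟨n, rfl⟩; exact (((hmem n).2 k).2 i).1⟩⟩
  choose x hx using hlim
  have hx' : Tendsto (fun n => T^[n] P) atTop (𝓝 x) :=
    tendsto_pi_nhds.2 fun k => tendsto_pi_nhds.2 fun i => hx k i
  refine ⟨x, ⟨fun k l hkl i => ?_, fun k => ⟨fun i j hij => ?_, fun i => ⟨?_, ?_⟩⟩⟩, ?_, hx'⟩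
  · exact le_of_tendsto_of_tendsto' (hx k i) (hx l i) fun n => (hmem n).1 hkl i
  · exact le_of_tendsto_of_tendsto' (hx k j) (hx k i) fun n => ((hmem n).2 k).1 hij
  · exact ge_of_tendsto' (hx k i) fun n => (((hmem n).2 k).2 i).1
  · exact le_of_tendsto' (hx k i) fun n => (((hmem n).2 k).2 i).2
  · have h1 : Tendsto (fun n => T^[n + 1] P) atTop (𝓝 (T x)) := by
      simp_rw [Function.iterate_succ_apply']
      exact (continuous_oneSidedDE.tendsto x).comp hx'
    exact tendsto_nhds_unique h1 ((tendsto_add_atTop_iff_nat 1).2 hx')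

end Sequences

/-! ### Shifting a fixed point of the one-sided system -/

/-- The sequence shifted by one position, with an initial term `0`. -/
def shift {m : ℕ} (x : ℕ → Fin m → ℝ) : ℕ → Fin m → ℝ := fun k => Nat.casesOn k 0 x

section

variable {m dv dc L w : ℕ} {D : Matrix (Fin m) (Fin m) ℝ} {F : (Fin m → ℝ) → ℝ → ℝ}
  {G : (Fin m → ℝ) → ℝ} {ε : ℝ}

theorem chainPot_seq (x : ℕ → Fin m → ℝ) :
    chainPot dc L w D F G ε (fun i : Fin (L + w - 1) => x i) =
    ∑ i ∈ Finset.range (L + w - 1), (g dc (x i) ⬝ᵥ D.mulVec (x i) - G (x i)) -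
      ∑ t ∈ Finset.range L, F (seqMessage dc w x t) ε := by
  rw [chainPot_eq, Finset.sum_range, Finset.sum_range]
  congr 1
  exact Finset.sum_congr rfl fun t _ =>
    congrArg (F · ε) (sum_coupling_row (fun i => g dc (x i)) t)

theorem convex_ccdfSet (m : ℕ) : Convex ℝ (ccdfSet m) := by
  intro x hx y hy a b ha hb hab
  refine ⟨fun i j hij => ?_, fun i => ⟨?_, ?_⟩⟩
  · exact add_le_add (mul_le_mul_of_nonneg_left (hx.1 hij) ha)
      (mul_le_mul_of_nonneg_left (hy.1 hij) hb)
  · exact add_nonneg (mul_nonneg ha (hx.2 i).1) (mul_nonneg hb (hy.2 i).1)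
  · have h1 := mul_le_mul_of_nonneg_left (hx.2 i).2 ha
    have h2 := mul_le_mul_of_nonneg_left (hy.2 i).2 hb
    simp only [Pi.add_apply, Pi.smul_apply, smul_eq_mul]
    linarith

theorem convex_domX (m : ℕ) (ε : ℝ) : Convex ℝ (domX m ε) := by
  intro x hx y hy a b ha hb hab
  refine ⟨fun i j hij => ?_, fun i => ⟨?_, ?_⟩⟩
  · exact add_le_add (mul_le_mul_of_nonneg_left (hx.1 hij) ha)
      (mul_le_mul_of_nonneg_left (hy.1 hij) hb)
  · exact add_nonneg (mul_nonneg ha (hx.2 i).1) (mul_nonneg hb (hy.2 i).1)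
  · have h1 := mul_le_mul_of_nonneg_left (hx.2 i).2 ha
    have h2 := mul_le_mul_of_nonneg_left (hy.2 i).2 hb
    have h3 : (a + b) * channelCCDF m ε i = channelCCDF m ε i := by rw [hab, one_mul]
    simp only [Pi.add_apply, Pi.smul_apply, smul_eq_mul]
    linarith

/-- `F` is nondecreasing on CCDF vectors, since its gradient `f D` is nonnegative there. -/
theorem F_mono (hP : IsPotentialData dv dc D F G) (hε : ε ∈ Icc (0 : ℝ) 1) {y z : Fin m → ℝ}
    (hy : y ∈ ccdfSet m) (hz : z ∈ ccdfSet m) (h : y ≤ z) : F y ε ≤ F z ε := by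
  have hd : ∀ s : ℝ, HasDerivAt (fun s : ℝ => F (y + s • (z - y)) ε)
      ((∑ i, (Matrix.vecMul (f dv ε (y + s • (z - y))) D i) •
        ContinuousLinearMap.proj (R := ℝ) (φ := fun _ : Fin m => ℝ) i) (z - y)) s := fun s => by
    have hline : HasDerivAt (fun s : ℝ => y + s • (z - y)) (z - y) s := by
      simpa using ((hasDerivAt_id s).smul_const (z - y)).const_add y
    exact (hP.F_grad ε hε _).comp_hasDerivAt s hline
  have hm : MonotoneOn (fun s : ℝ => F (y + s • (z - y)) ε) (Icc 0 1) := by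
    refine monotoneOn_of_deriv_nonneg (convex_Icc 0 1)
      (fun s _ => (hd s).continuousAt.continuousWithinAt)
      (fun s _ => (hd s).differentiableAt.differentiableWithinAt) fun s hs => ?_
    rw [(hd s).deriv]
    have hmem : y + s • (z - y) ∈ ccdfSet m :=
      (convex_ccdfSet m).add_smul_sub_mem hy hz (interior_subset hs)
    simp only [FunLike.coe_sum, FunLike.coe_smul, Finset.sum_apply, Pi.smul_apply,
      ContinuousLinearMap.proj_apply, smul_eq_mul]
    refine Finset.sum_nonneg fun i _ => mul_nonneg ?_ (sub_nonneg.2 (h i))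
    rw [Matrix.vecMul, dotProduct]
    refine Finset.sum_nonneg fun j _ => ?_
    exact mul_nonneg ((f_mem_domX hε hmem).2 j).1 (hP.pos j i).le
  simpa using hm (left_mem_Icc.2 zero_le_one) (right_mem_Icc.2 zero_le_one) zero_le_one

theorem shift_mem (hε : ε ∈ Icc (0 : ℝ) 1) {x : ℕ → Fin m → ℝ} (hx : x ∈ incSeqs m ε) :
    shift x ∈ incSeqs m ε := by
  refine ⟨monotone_nat_of_le_succ fun k => ?_, fun k => ?_⟩
  · cases k with
    | zero => exact fun i => ((hx.2 0).2 i).1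
    | succ k => exact hx.1 k.le_succ
  · cases k with
    | zero => exact zero_mem_domX hε
    | succ k => exact hx.2 k

/-- The shift lowers the coupled potential by at least the uncoupled potential at the last
position: all other contributions telescope. -/
theorem chainPot_shift_le (hP : IsPotentialData dv dc D F G) (hε : ε ∈ Icc (0 : ℝ) 1)
    (hL : 1 ≤ L) (hw : 1 ≤ w) {x : ℕ → Fin m → ℝ} (hx : x ∈ incSeqs m ε) {z : Fin m → ℝ}
    (hz : ∀ k, x k ≤ z) (hlast : x (L + w - 2) = z) :
    chainPot dc L w D F G ε (fun i : Fin (L + w - 1) => shift x i) ≤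
      chainPot dc L w D F G ε (fun i : Fin (L + w - 1) => x i) - potential dc D F G z ε := by
  have hx' := fun k => domX_subset_ccdfSet hε (hx.2 k)
  have hs' := fun k => domX_subset_ccdfSet hε ((shift_mem hε hx).2 k)
  have hzm : z ∈ ccdfSet m := hlast ▸ hx' _
  rw [chainPot_seq, chainPot_seq]
  set Q : ℕ → ℝ := fun k => g dc (shift x k) ⬝ᵥ D.mulVec (shift x k) - G (shift x k) with hQ
  set Φ : ℕ → ℝ := fun t => F (seqMessage dc w (shift x) t) ε with hΦ
  have e1 : ∀ i, g dc (x i) ⬝ᵥ D.mulVec (x i) - G (x i) = Q (i + 1) := fun i => rfl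
  have e2 : ∀ t, F (seqMessage dc w x t) ε = Φ (t + 1) := fun t => by
    have : seqMessage dc w x t = seqMessage dc w (shift x) (t + 1) := by
      unfold seqMessage
      congr 1
      refine Finset.sum_congr rfl fun k _ => ?_
      rw [add_right_comm]
      rfl
    rw [this]
  simp_rw [e1, e2]
  have t1 := Finset.sum_range_sub Q (L + w - 1)
  have t2 := Finset.sum_range_sub Φ L
  rw [Finset.sum_sub_distrib] at t1 t2
  have hQ0 : Q 0 = 0 := by
    have h0 : shift x 0 = 0 := rfl
    simp only [hQ, h0, Matrix.mulVec_zero, dotProduct_zero, hP.G_zero, sub_zero]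
  have hQN : Q (L + w - 1) = g dc z ⬝ᵥ D.mulVec z - G z := by
    rw [show L + w - 1 = (L + w - 2) + 1 by omega, ← e1, hlast]
  have hΦ0 : 0 ≤ Φ 0 := by
    rw [← hP.F_zero ε hε]
    have hm := seqMessage_mem (dc := dc) hw hs' 0
    exact F_mono hP hε (zero_mem_ccdfSet m) hm fun i => (hm.2 i).1
  have hΦL : Φ L ≤ F (g dc z) ε := by
    refine F_mono hP hε (seqMessage_mem hw hs' L) (g_mem hzm)
      (seqMessage_le hw hs' hzm (fun k => ?_) L)
    cases k with
    | zero => exact fun i => (hzm.2 i).1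
    | succ k => exact hz k
  unfold potential
  linarith

/-- A nonzero fixed point of the one-sided system bounds the energy gap. -/
theorem energyGap_le_of_fixedPoint (hP : IsPotentialData dv dc D F G) (hε : ε ∈ Icc (0 : ℝ) 1)
    (hL : 1 ≤ L) (hw : 1 ≤ w) {K : ℝ}
    (hK : ∀ X ∈ coupledDom m L w ε, normInf (coupledHessian dc L w D F G ε X) ≤ K)
    {x : ℕ → Fin m → ℝ} (hx : x ∈ incSeqs m ε) (hfix : oneSidedDE dv dc L w ε x = x)
    (hne : x ≠ 0) : energyGap dv dc D F G ε ≤ (((m : ℝ) * K / (2 * (w : ℝ)) : ℝ) : EReal) := by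
  set c := (L + w - 2) / 2 with hc
  set z := x c with hz
  have hxc : ∀ k, x k = seqDE dv dc L w ε x (min k c) := fun k => (congrFun hfix k).symm
  have hge : ∀ k, c ≤ k → x k = z := fun k hk => by
    rw [hz, hxc k, hxc c, min_eq_right hk, min_self]
  have hle : ∀ k, x k ≤ z := fun k => by
    rcases le_total k c with h | h
    · exact hx.1 h
    · exact (hge k h).le
  have hx' := fun k => domX_subset_ccdfSet hε (hx.2 k)
  have hs := shift_mem hε hx
  have hzm : z ∈ domX m ε := hx.2 c
  -- the value at the middle of the chain does not decrease under uncoupled density evolution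
  have hz1 : z ≤ f dv ε (g dc z) := by
    calc z = seqDE dv dc L w ε x (min c c) := hxc c
      _ ≤ _ := seqDE_le hε hw hx.2 hzm hle _
  have hiter : ∀ n : ℕ, (fun z => f dv ε (g dc z))^[n] z ∈ domX m ε ∧
      z ≤ (fun z => f dv ε (g dc z))^[n] z := by
    intro n
    induction n with
    | zero => exact ⟨hzm, le_rfl⟩
    | succ n ih =>
      rw [Function.iterate_succ_apply']
      have h1 := domX_subset_ccdfSet hε hzm
      have h2 := domX_subset_ccdfSet hε ih.1
      exact ⟨f_mem_domX hε (g_mem h2),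
        hz1.trans (f_mono hε (g_mem h1) (g_mem h2) (g_mono h1 h2 ih.2))⟩
  have hzbasin : z ∉ basinZero m dv dc ε := by
    intro h
    have hz0 : z ≤ 0 := ge_of_tendsto' h.2 fun n => (hiter n).2
    exact hne (funext fun k => le_antisymm ((hle k).trans hz0) fun i => ((hx.2 k).2 i).1)
  have hgap : energyGap dv dc D F G ε ≤ (potential dc D F G z ε : EReal) :=
    iInf₂_le z ⟨hzm, hzbasin⟩
  refine hgap.trans (EReal.coe_le_coe_iff.2 ?_)
  -- second-order expansion from the fixed point to its shift
  set Z : Fin (L + w - 1) → Fin m → ℝ := fun i => x i with hZ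
  set H : Fin (L + w - 1) → Fin m → ℝ := fun i => shift x i - x i with hH
  have hZH : Z + H = fun i : Fin (L + w - 1) => shift x i := by
    funext i
    change x i + (shift x i - x i) = shift x i
    abel
  have hd : HasDerivAt (fun s : ℝ => chainPot dc L w D F G ε (Z + s • H)) 0 0 := by
    refine (hasDerivAt_chainPot hP hε Z H).congr_deriv (Finset.sum_eq_zero fun i _ => ?_)
    rcases le_or_gt (i : ℕ) c with hi | hi
    · have : Z i - coupledDE dv dc L w ε (Matrix.of Z) i = 0 := by
        rw [sub_eq_zero]
        refine Eq.trans ?_ (coupledDE_seqMat x i).symm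
        have := hxc i
        rwa [min_eq_left hi] at this
      rw [this, Matrix.mulVec_zero, dotProduct_zero]
    · have : H i = 0 := by
        obtain ⟨k, hk⟩ : ∃ k, (i : ℕ) = k + 1 := ⟨i - 1, by omega⟩
        change shift x i - x i = 0
        rw [hk]
        change x k - x (k + 1) = 0
        rw [hge k (by omega), hge (k + 1) (by omega), sub_self]
      rw [this, map_zero, zero_dotProduct]
  -- consecutive windows differ by at most one row on either side, each with weight `1 / w`
  have hstep : ∀ k b, 0 ≤ shift x (k + 1) b - shift x k b ∧
      shift x (k + 1) b - shift x k b ≤ 1 / w := by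
    intro k b
    refine ⟨sub_nonneg.2 (hs.1 k.le_succ b), ?_⟩
    cases k with
    | zero =>
      change x 0 b - 0 ≤ _
      rw [sub_zero, hxc 0, Nat.zero_min]
      exact seqDE_zero_le hε hL hw hx.2 b
    | succ k =>
      change x (k + 1) b - x k b ≤ _
      rcases le_or_gt (k + 1) c with h | h
      · rw [hxc (k + 1), hxc k, min_eq_left h, min_eq_left (by omega), sub_le_iff_le_add']
        exact seqDE_succ_le hε hw hx.2 k b
      · rw [hge k (by omega), hge (k + 1) (by omega), sub_self]
        positivity
  have habs : ∀ i a, |H i a| = shift x ((i : ℕ) + 1) a - shift x i a := fun i a => by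
    have h : H i a = -(shift x ((i : ℕ) + 1) a - shift x i a) := (neg_sub _ _).symm
    rw [h, abs_neg, abs_of_nonneg (hstep _ _).1]
  have hsum : ∑ i, ∑ a, |H i a| ≤ m := by
    simp_rw [habs]
    rw [Finset.sum_comm]
    calc _ ≤ ∑ _a : Fin m, (1 : ℝ) := Finset.sum_le_sum fun a _ => by
          rw [← Finset.sum_range (fun i => shift x (i + 1) a - shift x i a),
            Finset.sum_range_sub fun i => shift x i a]
          have h0 : shift x 0 a = 0 := rfl
          rw [h0, sub_zero]
          exact ((domX_subset_ccdfSet hε (hs.2 _)).2 a).2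
      _ = m := by simp
  have hU := le_of_second_order (contDiff_chainPot hP hε L w) hd (C := m * K * (1 / w))
    fun s hs01 => by
      refine abs_second_deriv_le _ _ (hK _ fun i => ?_) (fun i a => ?_) (by positivity) hsum
      · exact (convex_domX m ε).add_smul_sub_mem (hx.2 i) (hs.2 i) hs01
      · rw [habs]; exact (hstep _ _).2
  rw [hZH] at hU
  have hshift := chainPot_shift_le hP hε hL hw hx hle (hge (L + w - 2) (by omega))
  have : (m : ℝ) * K / (2 * w) = m * K * (1 / w) / 2 := by ring
  rw [this]
  linarith

theorem tendsto_coupledDE (hP : IsPotentialData dv dc D F G) (hε : ε ∈ Icc (0 : ℝ) 1)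
    (hL : 1 ≤ L) (hw : 1 ≤ w) {K : ℝ}
    (hK : ∀ X ∈ coupledDom m L w ε, normInf (coupledHessian dc L w D F G ε X) ≤ K)
    (hgap : (((m : ℝ) * K / (2 * (w : ℝ)) : ℝ) : EReal) < energyGap dv dc D F G ε)
    {X : Matrix (Fin (L + w - 1)) (Fin m) ℝ} (hX : X ∈ coupledDom m L w ε) :
    Tendsto (fun ℓ : ℕ => (coupledDE dv dc L w ε)^[ℓ] X) atTop (𝓝 0) := by
  obtain ⟨x, hx, hfix, hlim⟩ := exists_tendsto_oneSidedDE (dv := dv) (dc := dc) (L := L) hε hw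
  have hx0 : x = 0 := by
    by_contra hne
    exact (energyGap_le_of_fixedPoint hP hε hL hw hK hx hfix hne).not_gt hgap
  rw [hx0] at hlim
  have hcmp := iterate_coupledDE_le (dv := dv) (dc := dc) hε hw hX (channel_mem_incSeqs hε)
    fun i _ a => ((hX i).2 a).2
  refine tendsto_pi_nhds.2 fun i => tendsto_pi_nhds.2 fun a => ?_
  refine squeeze_zero (fun n => (((hcmp n).1 i).2 a).1) (fun n => ((hcmp n).2.2 i).1 a) ?_
  exact tendsto_pi_nhds.1 (tendsto_pi_nhds.1 hlim i) a

theorem coupledDE_zero (hε : ε ∈ Icc (0 : ℝ) 1) :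
    coupledDE dv dc L w ε (0 : Matrix (Fin (L + w - 1)) (Fin m) ℝ) = 0 := by
  funext i
  rw [coupledDE_apply]
  have h0 : ∀ j, (0 : Matrix (Fin (L + w - 1)) (Fin m) ℝ) j = 0 := fun _ => rfl
  simp [h0, g_zero, f_zero hε]

end

end
end NBLDPC

theorem mainTheorem1 (m dv dc : ℕ) (hm : 1 ≤ m) (hdv : 2 ≤ dv) (hdc : 2 ≤ dc) :
    (∃ (D : Matrix (Fin m) (Fin m) ℝ) (F : (Fin m → ℝ) → ℝ → ℝ) (G : (Fin m → ℝ) → ℝ),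
      IsPotentialData dv dc D F G) ∧
    ∀ (D : Matrix (Fin m) (Fin m) ℝ) (F : (Fin m → ℝ) → ℝ → ℝ) (G : (Fin m → ℝ) → ℝ),
      IsPotentialData dv dc D F G →
      ∀ (L w : ℕ), 1 ≤ L → 1 ≤ w →
      ∀ ε ∈ Set.Icc (0 : ℝ) 1, ε < thresholdPot dv dc D F G →
      ∀ K : ℝ, (∀ X ∈ coupledDom m L w ε, normInf (coupledHessian dc L w D F G ε X) ≤ K) →
      (((m : ℝ) * K / (2 * (w : ℝ)) : ℝ) : EReal) < energyGap dv dc D F G ε →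
      (∀ X ∈ coupledDom m L w ε, X = coupledDE dv dc L w ε X ↔ X = 0) ∧
      (∀ X ∈ coupledDom m L w ε,
        Filter.Tendsto (fun ℓ : ℕ => (coupledDE dv dc L w ε)^[ℓ] X) Filter.atTop (nhds 0)) := by
  refine ⟨exists_isPotentialData m dv dc hdv hdc, fun D F G hP L w hL hw ε hε _ K hK hgap => ?_⟩
  have hlim := fun X hX => tendsto_coupledDE hP hε hL hw hK hgap (X := X) hX
  refine ⟨fun X hX => ⟨fun h => ?_, fun h => ?_⟩, hlim⟩
  · have hconst : ∀ n : ℕ, (coupledDE dv dc L w ε)^[n] X = X :=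
      fun n => Function.iterate_fixed h.symm n
    have := hlim X hX
    simp_rw [hconst] at this
    exact tendsto_nhds_unique tendsto_const_nhds this
  · rw [h, coupledDE_zero hε]
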